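/- Let $\overline{\mathbb Q}\subset\mathbb C$ be the field of algebraic numbers, $\mathbf K=\bigcup_{d\ge 1}\overline{\mathbb Q}((z^{1/d}))$ the field of Puiseux series, $p\ge 2$ and $m\ge 1$ integers, $\phi_p(f)(z)=f(z^p)$ (applied entrywise to matrices), and $A\in \mathrm{GL}_m(\overline{\mathbb Q}(z))$. The Mahler system $\phi_p(Y)=AY$ is regular singular at $0$ if there is $\Psi\in\mathrm{GL}_m(\mathbf K)$ such that $\phi_p(\Psi)^{-1}A\Psi$ is a constant matrix (entries in $\overline{\mathbb Q}$); such a $\Psi$ is called an associated gauge transformation. Let $\mathcal D=\{d\in\mathbb N : 1\le d\le p^m-1,\ \gcd(d,p)=1\}$. **Proposition.** If the system is regular singular at $0$ with associated gauge transformation $\Psi\in\mathrm{GL}_m(\mathbf K)$, then $\Psi\in\mathrm{GL}_m(\overline{\mathbb Q}((z^{1/d})))$ for some $d\in\mathcal D$. Moreover, the algorithm below, with input $(A,p)$, always returns an integer; and every integer $d$ that it may return lies in $\mathcal D$ and satisfies $\Psi\in\mathrm{GL}_m(\overline{\mathbb Q}((z^{1/d})))$ for every associated gauge transformation $\Psi$.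 **Algorithm.** 1. (Companion equation.) For a nonzero polynomial $h=\sum_{k\le n}h_kz^k$ of degree $n$ put $\|h\|=1+\max_{k<n}|h_k|/|h_n|$ (with $\|h\|=1$ if $n=0$). Let $z_0$ be the maximum of $\|f\|$ and of the $\|g\|$, where $f$ is the numerator of $\det A$ and $g$ runs over the denominators of the entries of $A$ (all in lowest terms); if this maximum is $1$, put $z_0=2$ instead. Choose a row vector $r\in\overline{\mathbb Q}[z]^m$ such that $r(z_0^{p^{k}})=e_{k+1}A(z_0)^{-1}A(z_0^p)^{-1}\cdots A(z_0^{p^{k-1}})^{-1}$ for $0\le k\le m-1$, where $e_1,\dots,e_m$ are the standard basis row vectors. Put $r_1=r$, $r_{i+1}=\phi_p(r_i)A$, let $P$ be the matrix with rows $r_1,\dots,r_m$, and let $(q_0,\dots,q_{m-1})=\phi_p(r_m)AP^{-1}$. (For every choice of $r$, the matrix $P$ is invertible, and $\phi_p(P)AP^{-1}$ is the companion matrix with ones above the diagonal, last row $(q_0,\dots,q_{m-1})$, and zeros elsewhere.) 2. (Newton polygon.) Let $\mathcal H$ be the lower hull (the lower boundary of the convex hull in $\mathbb R^2$) of $\{(p^i,v_0(q_i))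 : 0\le i\le m-1,\ q_i\ne 0\}\cup\{(p^m,0)\}$, where $v_0$ is the valuation at $z=0$. Return the least common multiple of those denominators, in lowest terms, of slopes of $\mathcal H$ that are coprime to $p$ (this is $1$ if there are none). -/

import Mathlib

namespace MahlerSystem

/-- The field of algebraic numbers, as a subfield of `ℂ` (and with the absolute value of `ℂ`). -/
noncomputable abbrev QBar : Type := algebraicClosure ℚ ℂ

/-- Hahn series in `z` with rational exponents and algebraic coefficients: the ambient field in
which Puiseux series are computed. -/
noncomputable abbrev HahnField : Type := HahnSeries ℚ QBar

/-! ### Laurent series in `z^{1/d}` and Puiseux series -/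

/-- The Hahn series all of whose exponents lie in a given additive subgroup `S` of `ℚ`. -/
noncomputable def exponentsIn (S : AddSubgroup ℚ) : Subfield HahnField :=
  (HahnSeries.embDomainRingHom (R := QBar) S.subtype S.subtype_injective
    (fun _ _ => Iff.rfl)).fieldRange

theorem mem_exponentsIn {S : AddSubgroup ℚ} {x : HahnField} :
    x ∈ exponentsIn S ↔ ∀ q ∈ x.support, q ∈ S := by
  constructor
  · rintro ⟨y, rfl⟩ q hq
    obtain ⟨s, -, rfl⟩ := HahnSeries.support_embDomain_subset hq
    exact s.2
  · intro h
    refine ⟨⟨fun s => x.coeff s, ?_⟩, ?_⟩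
    · intro f
      let g : ℕ → {q : ℚ // q ∈ x.support} := fun k => ⟨((f k : S) : ℚ), (f k).2⟩
      obtain ⟨a, b, hab, hle⟩ := x.isPWO_support g
      exact ⟨a, b, hab, hle⟩
    · refine HahnSeries.ext (funext fun q => ?_)
      by_cases hq : q ∈ S
      · exact HahnSeries.embDomain_coeff (a := (⟨q, hq⟩ : S))
      · have h0 : x.coeff q = 0 := by
          by_contra hne
          exact hq (h q hne)
        rw [h0]
        refine HahnSeries.embDomain_notin_image_support ?_
        rintro ⟨s, -, rfl⟩
        exact hq s.2

/-- The field `ℚ̄((z^{1/d}))` (for `d ≥ 1`): series whose exponents lie in `(1/d)ℤ`. A well-ordered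
subset of `(1/d)ℤ` is bounded below, so that these are the Laurent series in `z^{1/d}`. -/
noncomputable def laurentRoot (d : ℕ) : Subfield HahnField :=
  exponentsIn (AddSubgroup.zmultiples (1 / (d : ℚ)))

theorem mem_laurentRoot {d : ℕ} {x : HahnField} :
    x ∈ laurentRoot d ↔ ∀ q ∈ x.support, ∃ n : ℤ, q = n / (d : ℚ) := by
  simp only [laurentRoot, mem_exponentsIn, AddSubgroup.mem_zmultiples_iff]
  refine forall₂_congr fun q _ => exists_congr fun n => ?_
  rw [zsmul_eq_mul, mul_one_div]
  exact eq_comm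

theorem laurentRoot_mono {d e : ℕ} (he : 1 ≤ e) (h : d ∣ e) : laurentRoot d ≤ laurentRoot e := by
  obtain ⟨c, rfl⟩ := h
  intro x hx
  rw [mem_laurentRoot] at hx ⊢
  intro q hq
  obtain ⟨n, rfl⟩ := hx q hq
  have hd : (d : ℚ) ≠ 0 := by
    rintro h0
    have : d = 0 := by exact_mod_cast h0
    simp [this] at he
  have hc : (c : ℚ) ≠ 0 := by
    rintro h0
    have : c = 0 := by exact_mod_cast h0
    simp [this] at he
  refine ⟨n * c, ?_⟩
  push_cast
  field_simp

/-- The field `𝐊 = ⋃_{d ≥ 1} ℚ̄((z^{1/d}))` of Puiseux series with algebraic coefficients. -/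
noncomputable def puiseux : Subfield HahnField where
  carrier := {x | ∃ d : ℕ, 1 ≤ d ∧ x ∈ laurentRoot d}
  mul_mem' := by
    rintro x y ⟨d, hd, hx⟩ ⟨e, he, hy⟩
    have hde : 1 ≤ d * e := Nat.mul_pos hd he
    exact ⟨d * e, hde, mul_mem (laurentRoot_mono hde (dvd_mul_right d e) hx)
      (laurentRoot_mono hde (dvd_mul_left e d) hy)⟩
  one_mem' := ⟨1, le_rfl, one_mem _⟩
  add_mem' := by
    rintro x y ⟨d, hd, hx⟩ ⟨e, he, hy⟩
    have hde : 1 ≤ d * e := Nat.mul_pos hd he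
    exact ⟨d * e, hde, add_mem (laurentRoot_mono hde (dvd_mul_right d e) hx)
      (laurentRoot_mono hde (dvd_mul_left e d) hy)⟩
  zero_mem' := ⟨1, le_rfl, zero_mem _⟩
  neg_mem' := by
    rintro x ⟨d, hd, hx⟩
    exact ⟨d, hd, neg_mem hx⟩
  inv_mem' := by
    rintro x ⟨d, hd, hx⟩
    exact ⟨d, hd, inv_mem hx⟩

noncomputable abbrev PuiseuxField : Type := puiseux

/-! ### The Mahler operator and the embeddings into Puiseux series -/

/-- `f(z) ↦ f(z^p)` on Hahn series. -/
noncomputable def hahnMahler (p : ℕ) [NeZero p] : HahnField →+* HahnField :=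
  HahnSeries.embDomainRingHom (AddMonoidHom.mulLeft (p : ℚ))
    (mul_right_injective₀ (by exact_mod_cast NeZero.ne p))
    (fun _ _ => mul_le_mul_iff_right₀ (by exact_mod_cast NeZero.pos p))

theorem hahnMahler_mem (p : ℕ) [NeZero p] {x : HahnField} (hx : x ∈ puiseux) :
    hahnMahler p x ∈ puiseux := by
  obtain ⟨d, hd, hx⟩ := hx
  refine ⟨d, hd, ?_⟩
  rw [mem_laurentRoot] at hx ⊢
  intro q hq
  obtain ⟨s, hs, rfl⟩ := HahnSeries.support_embDomain_subset hq
  obtain ⟨n, rfl⟩ := hx s hs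
  refine ⟨p * n, ?_⟩
  change (p : ℚ) * (n / d) = _
  push_cast
  ring

/-- The Mahler operator `φ_p : 𝐊 → 𝐊`, `f(z) ↦ f(z^p)`. -/
noncomputable def mahler (p : ℕ) [NeZero p] : PuiseuxField →+* PuiseuxField :=
  ((hahnMahler p).comp puiseux.subtype).codRestrict puiseux
    (fun x => hahnMahler_mem p x.2)

/-- The Mahler operator on rational functions, `f(z) ↦ f(z^p)`. -/
noncomputable def ratMahler (p : ℕ) [NeZero p] : RatFunc QBar →+* RatFunc QBar :=
  RatFunc.mapRingHom (Polynomial.expand QBar p)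
    (nonZeroDivisors_le_comap_nonZeroDivisors_of_injective _
      (Polynomial.expand_injective (NeZero.pos p)))

/-- Laurent series in `z`, seen as Hahn series with rational exponents. -/
noncomputable def laurentToHahn : LaurentSeries QBar →+* HahnField :=
  HahnSeries.embDomainRingHom (Int.castAddHom ℚ) Int.cast_injective (fun _ _ => Int.cast_le)

theorem laurentToHahn_mem (x : LaurentSeries QBar) : laurentToHahn x ∈ puiseux := by
  refine ⟨1, le_rfl, ?_⟩
  rw [mem_laurentRoot]
  intro q hq
  obtain ⟨n, -, rfl⟩ := HahnSeries.support_embDomain_subset hq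
  exact ⟨n, by simp⟩

open scoped RatFunc in
/-- The expansion of rational functions at `0` as Laurent series in `z`. -/
noncomputable def ratToLaurent : RatFunc QBar →+* LaurentSeries QBar :=
  algebraMap (RatFunc QBar) (LaurentSeries QBar)

/-- The embedding `ℚ̄(z) → 𝐊`: expansion of rational functions at `0`. -/
noncomputable def ratToPuiseux : RatFunc QBar →+* PuiseuxField :=
  (laurentToHahn.comp ratToLaurent).codRestrict puiseux
    (fun _ => laurentToHahn_mem _)

/-- The embedding `ℚ̄ → 𝐊` of the constants. -/
noncomputable def constToPuiseux : QBar →+* PuiseuxField :=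
  ratToPuiseux.comp RatFunc.C

/-! ### Gauge transformations -/

section Gauge

variable {m : ℕ}

/-- `Ψ ∈ GL_m(𝐊)` is a gauge transformation from the system `φ_p(Y) = A Y` to a constant system:
`φ_p(Ψ)⁻¹ A Ψ` is a matrix with entries in `ℚ̄`. -/
def IsConstantGauge (p : ℕ) [NeZero p] (A : Matrix.GeneralLinearGroup (Fin m) (RatFunc QBar))
    (Ψ : Matrix.GeneralLinearGroup (Fin m) PuiseuxField) : Prop :=
  ∃ Λ : Matrix (Fin m) (Fin m) QBar,
    ((((Matrix.GeneralLinearGroup.map (mahler p) Ψ)⁻¹ *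
      Matrix.GeneralLinearGroup.map ratToPuiseux A * Ψ :
        Matrix.GeneralLinearGroup (Fin m) PuiseuxField)) :
          Matrix (Fin m) (Fin m) PuiseuxField) = Λ.map constToPuiseux

/-- `Ψ` belongs to `GL_m(ℚ̄((z^{1/d})))`. -/
def InGLLaurentRoot (d : ℕ) (Ψ : Matrix.GeneralLinearGroup (Fin m) PuiseuxField) : Prop :=
  Matrix.GeneralLinearGroup.map puiseux.subtype Ψ ∈
    (Matrix.GeneralLinearGroup.map (n := Fin m) (laurentRoot d).subtype).range

end Gauge

/-- The set `𝒟` of the integers `1 ≤ d ≤ p^m - 1` with `gcd(d, p) = 1`. -/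
def ramificationSet (p m : ℕ) : Set ℕ :=
  {d | 1 ≤ d ∧ d ≤ p ^ m - 1 ∧ Nat.gcd d p = 1}

/-! ### The cyclic vector algorithm -/

section Cyclic

variable {m : ℕ}

/-- The maximum of `‖f‖`, for `f` the numerator of `det A`, and of the `‖g‖`, for `g` the
denominators of the entries of `A`. Here `‖h‖ = 1 + max_{k < deg h} |h_k| / |h_{deg h}|`, which is
`Polynomial.cauchyBound`. -/
noncomputable def rootBound (A : Matrix (Fin m) (Fin m) (RatFunc QBar)) : ℝ :=
  (Finset.univ : Finset (Fin m × Fin m)).fold max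
    ((Polynomial.cauchyBound A.det.num : NNReal) : ℝ)
    (fun ij => ((Polynomial.cauchyBound (A ij.1 ij.2).denom : NNReal) : ℝ))

/-- The interpolation point: `rootBound A`, except that `1`, a root of unity, is replaced by `2`. -/
noncomputable def startPoint (A : Matrix (Fin m) (Fin m) (RatFunc QBar)) : ℝ :=
  open scoped Classical in if rootBound A = 1 then 2 else rootBound A

/-- The value `A(w)` of a matrix of rational functions. -/
noncomputable def evalAt (A : Matrix (Fin m) (Fin m) (RatFunc QBar)) (w : QBar) :
    Matrix (Fin m) (Fin m) QBar :=
  A.map (RatFunc.eval (RingHom.id QBar) w)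

/-- The polynomial row vector `r` satisfies
`r(z₀^{p^k}) = e_{k+1} A(z₀)⁻¹ A(z₀^p)⁻¹ ⋯ A(z₀^{p^{k-1}})⁻¹` for `0 ≤ k < m`. -/
def Interpolates (p : ℕ) (A : Matrix (Fin m) (Fin m) (RatFunc QBar)) (z₀ : QBar)
    (r : Fin m → Polynomial QBar) : Prop :=
  ∀ k : Fin m, (fun j => (r j).eval (z₀ ^ p ^ (k : ℕ))) =
    Matrix.vecMul (Pi.single k 1)
      ((List.range (k : ℕ)).map (fun l => (evalAt A (z₀ ^ p ^ l))⁻¹)).prod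

/-- The row vectors `r, φ_p(r) A, φ_p(φ_p(r) A) A, …`. -/
noncomputable def cyclicRow (p : ℕ) [NeZero p] (A : Matrix (Fin m) (Fin m) (RatFunc QBar))
    (r : Fin m → Polynomial QBar) : ℕ → Fin m → RatFunc QBar
  | 0 => fun j => algebraMap (Polynomial QBar) (RatFunc QBar) (r j)
  | i + 1 => Matrix.vecMul (fun j => ratMahler p (cyclicRow p A r i j)) A

/-- `(P, q)` is a possible output of the cyclic vector algorithm with input `A`, `p`: `P` has the
rows `r₁ = r`, `r_{i+1} = φ_p(r_i) A` and `q = φ_p(r_m) A P⁻¹`, for some polynomial row vector `r`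
that satisfies the interpolation conditions at the starting point. -/
def CyclicVectorOutput (p : ℕ) [NeZero p] (A : Matrix (Fin m) (Fin m) (RatFunc QBar))
    (P : Matrix (Fin m) (Fin m) (RatFunc QBar)) (q : Fin m → RatFunc QBar) : Prop :=
  ∃ (z₀ : QBar) (r : Fin m → Polynomial QBar),
    (z₀ : ℂ) = ((startPoint A : ℝ) : ℂ) ∧ Interpolates p A z₀ r ∧
    P = Matrix.of (fun i : Fin m => cyclicRow p A r i) ∧
    q = Matrix.vecMul (cyclicRow p A r m) P⁻¹

/-- The companion matrix with ones above the diagonal and last row `q`. -/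
noncomputable def companion (q : Fin m → RatFunc QBar) :
    Matrix (Fin m) (Fin m) (RatFunc QBar) :=
  Matrix.of fun i j =>
    if (i : ℕ) + 1 = m then q j else if (j : ℕ) = (i : ℕ) + 1 then 1 else 0

end Cyclic

/-! ### The Newton polygon -/

section Newton

variable {m : ℕ}

/-- The valuation at `0` of a nonzero rational function. -/
noncomputable def valZero (f : RatFunc QBar) : ℤ :=
  (ratToLaurent f).order

/-- The points `(p^i, v₀(q_i))`, `q_i ≠ 0`, together with `(p^m, 0)`. -/
noncomputable def newtonPoints (p : ℕ) (q : Fin m → RatFunc QBar) : Finset (ℤ × ℤ) :=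
  open scoped Classical in
  insert ((p : ℤ) ^ m, 0)
    ((Finset.univ.filter (fun i : Fin m => q i ≠ 0)).image
      (fun i : Fin m => ((p : ℤ) ^ (i : ℕ), valZero (q i))))

/-- A point with integer coordinates as a point of the real plane. -/
def toPlane (a : ℤ × ℤ) : ℝ × ℝ := ((a.1 : ℝ), (a.2 : ℝ))

/-- The lower hull of a set of points of the plane: the lower boundary of its convex hull. -/
def lowerHull (S : Set (ℝ × ℝ)) : Set (ℝ × ℝ) :=
  {a | a ∈ convexHull ℝ S ∧ ∀ b ∈ convexHull ℝ S, b.1 = a.1 → a.2 ≤ b.2}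

/-- The slopes of the lower hull of a finite set of points with integer coordinates: the slopes of
the non-vertical segments that join two of the points and are contained in the lower hull. -/
noncomputable def hullSlopes (S : Finset (ℤ × ℤ)) : Finset ℚ :=
  open scoped Classical in
  ((S ×ˢ S).filter (fun ab => ab.1.1 < ab.2.1 ∧
      segment ℝ (toPlane ab.1) (toPlane ab.2) ⊆ lowerHull (toPlane '' (S : Set (ℤ × ℤ))))).image
    (fun ab => ((ab.2.2 - ab.1.2 : ℤ) : ℚ) / ((ab.2.1 - ab.1.1 : ℤ) : ℚ))

/-- The least common multiple of those denominators of slopes of the lower hull that are coprime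
to `p` (it is `1` if there are none). -/
noncomputable def newtonIndex (p : ℕ) (q : Fin m → RatFunc QBar) : ℕ :=
  (((hullSlopes (newtonPoints p q)).image Rat.den).filter (fun n => Nat.gcd n p = 1)).lcm id

end Newton

/-- `d` is a possible output, for the input `A`, `p`, of the algorithm that first finds a companion
system with the cyclic vector algorithm and then reads `d` off the Newton polygon of its last row. -/
def RamificationOutput {m : ℕ} (p : ℕ) [NeZero p] (A : Matrix (Fin m) (Fin m) (RatFunc QBar))
    (d : ℕ) : Prop :=
  ∃ (P : Matrix (Fin m) (Fin m) (RatFunc QBar)) (q : Fin m → RatFunc QBar),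
    CyclicVectorOutput p A P q ∧ d = newtonIndex p q

end MahlerSystem

namespace MahlerSystem

/-! ### Slopes of lower hulls -/

/-! Write φ for `z ↦ z^p`, let `P` and `q` come from the algorithm, let `Λ` be the constant matrix
attached to `Ψ`, and let `d` be the Newton index. The matrix `Θ = PΨ` satisfies `φ(Θ)Λ =
companion(q)Θ`. Hence the first entry `l v` of `Θv`, for a constant vector `v`, satisfies `∑ q_i
φ^i(l(Λ^i v)) = 0` with `q_m = -1`. On a generalized eigenspace of `Λ` for `μ ≠ 0`, `Λ^i v` is `μ^i
v` up to vectors of smaller depth. Induction on the depth therefore leaves a scalar equation `∑ q_i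
μ^i φ^i f = g` with `g` in `ℚ̄((z^{1/d}))` (`linearMap_mem_laurentRoot_newtonIndex`).

The scalar equation forces `f` into the same field (`mem_laurentRoot_newtonIndex`). Since `q_0 ≠ 0`,
`f` is expressed through `g` and the `φ^i f` with `i ≥ 1`, whose ramification has lost a factor
shared with `p`; by descent `f` has exponents in `(1/e)ℤ` with `e` prime to `p`. Among those,
multiplication by `p` preserves both `(1/d)ℤ` and its complement, so the part of `f` off `(1/d)ℤ`
solves the homogeneous equation. If it were nonzero, its order would be minus a slope of the Newton
polygon, with denominator prime to `p`, hence dividing `d`: a contradiction.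

The bound `d ≤ p^m - 1` holds because distinct slopes occupy disjoint intervals `[i, j)` of
exponents of `p`, and a slope denominator prime to `p` divides `p^(j-i) - 1`
(`newtonIndex_mem_ramificationSet`). The algorithm works because the interpolation conditions say
exactly that `P(z₀) = 1`, where `z₀` and its powers `z₀^(p^l)` avoid the poles of `A` and the zeros
of `det A`. -/

theorem segment_subset_lowerHull_iff {S : Set (ℝ × ℝ)} {a b : ℝ × ℝ} (ha : a ∈ S) (hb : b ∈ S)
    (hab : a.1 < b.1) :
    segment ℝ a b ⊆ lowerHull S ↔
      ∀ c ∈ S, (b.2 - a.2) * (c.1 - a.1) ≤ (c.2 - a.2) * (b.1 - a.1) := by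
  have hconv : ∀ {x y : ℝ × ℝ}, x ∈ S → y ∈ S → ∀ t : ℝ, 0 ≤ t → t ≤ 1 →
      ((1 - t) * x.1 + t * y.1, (1 - t) * x.2 + t * y.2) ∈ convexHull ℝ S := by
    intro x y hx hy t h0 h1
    exact (convex_convexHull ℝ S) (subset_convexHull ℝ S hx) (subset_convexHull ℝ S hy)
      (sub_nonneg.2 h1) h0 (by ring)
  constructor
  · intro h c hc
    -- Compare heights at one abscissa: if `c` is left of `a`, the point `a` is below the chord from
    -- `b` to `c`; if `c` is right of `b`, the point `b` is below the chord from `a` to `c`;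
    -- otherwise a point of the segment is below `c`.
    rcases lt_or_ge c.1 a.1 with hca | hca
    · have hpos : 0 < b.1 - c.1 := by linarith
      have key := (h (left_mem_segment ℝ a b)).2 _
        (hconv hb hc ((b.1 - a.1) / (b.1 - c.1)) (by apply div_nonneg <;> linarith)
          (by rw [div_le_one hpos]; linarith)) (by simp only []; field_simp; ring)
      have h2 := mul_le_mul_of_nonneg_right key hpos.le
      have h3 : ((1 - (b.1 - a.1) / (b.1 - c.1)) * b.2 + (b.1 - a.1) / (b.1 - c.1) * c.2) *
          (b.1 - c.1) = (a.1 - c.1) * b.2 + (b.1 - a.1) * c.2 := by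
        field_simp; ring
      simp only [] at h2
      rw [h3] at h2
      linarith
    · rcases lt_or_ge b.1 c.1 with hcb | hcb
      · have hpos : 0 < c.1 - a.1 := by linarith
        have key := (h (right_mem_segment ℝ a b)).2 _
          (hconv ha hc ((b.1 - a.1) / (c.1 - a.1)) (by apply div_nonneg <;> linarith)
            (by rw [div_le_one hpos]; linarith)) (by simp only []; field_simp; ring)
        have h2 := mul_le_mul_of_nonneg_right key hpos.le
        have h3 : ((1 - (b.1 - a.1) / (c.1 - a.1)) * a.2 + (b.1 - a.1) / (c.1 - a.1) * c.2) *
            (c.1 - a.1) = (c.1 - b.1) * a.2 + (b.1 - a.1) * c.2 := by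
          field_simp; ring
        simp only [] at h2
        rw [h3] at h2
        linarith
      · have hpos : 0 < b.1 - a.1 := by linarith
        have hmem : ((1 - (c.1 - a.1) / (b.1 - a.1)) * a.1 + (c.1 - a.1) / (b.1 - a.1) * b.1,
            (1 - (c.1 - a.1) / (b.1 - a.1)) * a.2 + (c.1 - a.1) / (b.1 - a.1) * b.2) ∈
            segment ℝ a b :=
          ⟨1 - (c.1 - a.1) / (b.1 - a.1), (c.1 - a.1) / (b.1 - a.1),
            sub_nonneg.2 (by rw [div_le_one hpos]; linarith), by apply div_nonneg <;> linarith,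
            by ring, rfl⟩
        have key := (h hmem).2 c (subset_convexHull ℝ S hc) (by simp only []; field_simp; ring)
        have h2 := mul_le_mul_of_nonneg_right key hpos.le
        have h3 : ((1 - (c.1 - a.1) / (b.1 - a.1)) * a.2 + (c.1 - a.1) / (b.1 - a.1) * b.2) *
            (b.1 - a.1) = (b.1 - c.1) * a.2 + (c.1 - a.1) * b.2 := by
          field_simp; ring
        simp only [] at h2
        rw [h3] at h2
        linarith
  · intro h w hw
    -- The half-plane above the line through `a` and `b` is convex, so it contains the hull as soon
    -- as it contains `S`.
    have hhalf : convexHull ℝ S ⊆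
        {c : ℝ × ℝ | (b.2 - a.2) * (c.1 - a.1) ≤ (c.2 - a.2) * (b.1 - a.1)} := by
      refine convexHull_min h ?_
      intro x hx y hy s t hs ht hst
      obtain rfl : s = 1 - t := by linarith
      simp only [Set.mem_ofPred_eq, Prod.fst_add, Prod.snd_add, Prod.smul_fst, Prod.smul_snd,
        smul_eq_mul] at hx hy ⊢
      have h1 := mul_le_mul_of_nonneg_left hx hs
      have h2 := mul_le_mul_of_nonneg_left hy ht
      linarith
    obtain ⟨s, t, hs, ht, hst, rfl⟩ := hw
    obtain rfl : s = 1 - t := by linarith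
    refine ⟨hconv ha hb t ht (by linarith), fun u hu hu1 => ?_⟩
    have := hhalf hu
    simp only [Set.mem_ofPred_eq, Prod.fst_add, Prod.snd_add, Prod.smul_fst, Prod.smul_snd,
      smul_eq_mul] at this hu1 ⊢
    rw [hu1] at this
    have hpos : 0 < b.1 - a.1 := by linarith
    refine le_of_mul_le_mul_right ?_ hpos
    linarith

/-- Replaces the real convex hull by rational supporting-line inequalities, the only form in which
slopes are used afterwards. -/
theorem mem_hullSlopes {S : Finset (ℤ × ℤ)} {s : ℚ} :
    s ∈ hullSlopes S ↔ ∃ a ∈ S, ∃ b ∈ S, a.1 < b.1 ∧ s * (b.1 - a.1) = b.2 - a.2 ∧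
      ∀ c ∈ S, s * (c.1 - a.1) ≤ c.2 - a.2 := by
  have key : ∀ a ∈ S, ∀ b ∈ S, a.1 < b.1 → ∀ t : ℚ, t * (b.1 - a.1) = b.2 - a.2 →
      (segment ℝ (toPlane a) (toPlane b) ⊆ lowerHull (toPlane '' (S : Set (ℤ × ℤ))) ↔
        ∀ c ∈ S, t * (c.1 - a.1) ≤ c.2 - a.2) := by
    intro a ha b hb hab t ht
    rw [segment_subset_lowerHull_iff (Set.mem_image_of_mem _ ha) (Set.mem_image_of_mem _ hb)
      (by simpa [toPlane] using hab), Set.forall_mem_image]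
    refine forall₂_congr fun c _ => ?_
    have hpos : (0 : ℚ) < b.1 - a.1 := by
      rw [sub_pos]; exact_mod_cast hab
    rw [← mul_le_mul_iff_left₀ hpos, show t * ((c.1 : ℚ) - a.1) * (b.1 - a.1) =
      (t * (b.1 - a.1)) * (c.1 - a.1) by ring, ht]
    simp only [toPlane]
    norm_cast
  have hslope : ∀ a b : ℤ × ℤ, a.1 < b.1 →
      ((b.2 - a.2 : ℤ) : ℚ) / ((b.1 - a.1 : ℤ) : ℚ) * (b.1 - a.1) = b.2 - a.2 := by
    intro a b hab
    have hpos : (b.1 : ℚ) - a.1 ≠ 0 := by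
      rw [sub_ne_zero]; exact_mod_cast hab.ne'
    push_cast
    field_simp
  simp only [hullSlopes, Finset.mem_image, Finset.mem_filter, Finset.mem_product, Prod.exists]
  constructor
  · rintro ⟨a, b, a', b', ⟨⟨h1, h2⟩, h3, h4⟩, rfl⟩
    exact ⟨a, b, h1, a', b', h2, h3, hslope (a, b) (a', b') h3, (key _ h1 _ h2 h3 _ (hslope (a, b) (a', b') h3)).1 h4⟩
  · rintro ⟨a, b, h1, a', b', h2, h3, h4, h5⟩
    refine ⟨a, b, a', b', ⟨⟨h1, h2⟩, h3, (key _ h1 _ h2 h3 _ h4).2 h5⟩, ?_⟩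
    have hpos : (((a' - a : ℤ)) : ℚ) ≠ 0 := by
      rw [Ne, Int.cast_eq_zero, sub_eq_zero]; exact h3.ne'
    rw [div_eq_iff hpos]
    push_cast
    exact h4.symm

/-! ### The Newton polygon of a companion equation -/

section Newton

variable {m : ℕ}

/-- The coefficients `q₀, …, q_{m-1}, -1` of the Mahler operator `-φ^m + ∑ q_i φ^i`. -/
noncomputable def operatorCoeff (q : Fin m → RatFunc QBar) (i : ℕ) : RatFunc QBar :=
  if h : i < m then q ⟨i, h⟩ else -1

theorem mem_newtonPoints {p : ℕ} {q : Fin m → RatFunc QBar} {c : ℤ × ℤ} :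
    c ∈ newtonPoints p q ↔
      ∃ i ≤ m, operatorCoeff q i ≠ 0 ∧ c = ((p : ℤ) ^ i, valZero (operatorCoeff q i)) := by
  have hm : valZero (-1) = 0 := by
    simp [valZero, HahnSeries.order_neg]
  simp only [newtonPoints, Finset.mem_insert, Finset.mem_image, Finset.mem_filter,
    Finset.mem_univ, true_and]
  constructor
  · rintro (rfl | ⟨i, hi, rfl⟩)
    · exact ⟨m, le_rfl, by simp [operatorCoeff, hm]⟩
    · exact ⟨i, i.2.le, by simp [operatorCoeff, hi]⟩
  · rintro ⟨i, hi, h0, rfl⟩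
    rcases hi.lt_or_eq with h | rfl
    · right
      exact ⟨⟨i, h⟩, by simpa [operatorCoeff, h] using h0, by simp [operatorCoeff, h]⟩
    · left
      simp [operatorCoeff, hm]

/-- Since `s · p^i (p^(j-i) - 1)` is an integer, the denominator divides `p^i (p^(j-i) - 1)`, and it
is prime to the first factor. -/
theorem coprime_den_dvd {p i j : ℕ} (hij : i < j) {s : ℚ} {n : ℤ}
    (hs : s * ((p : ℚ) ^ j - (p : ℚ) ^ i) = n) (hp : 1 ≤ p) (hc : Nat.gcd s.den p = 1) :
    s.den ∣ p ^ (j - i) - 1 := by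
  have hN : ((p ^ i * (p ^ (j - i) - 1) : ℕ) : ℚ) = (p : ℚ) ^ j - (p : ℚ) ^ i := by
    push_cast [Nat.cast_sub (Nat.one_le_pow _ _ hp)]
    rw [mul_sub, ← pow_add, Nat.add_sub_cancel' hij.le, mul_one]
  rw [← hN] at hs
  have h1 : (s.num * (p ^ i * (p ^ (j - i) - 1) : ℕ) : ℤ) = n * s.den := by
    have : (s.num : ℚ) = s * s.den := (Rat.mul_den_eq_num s).symm
    have h2 : ((s.num * (p ^ i * (p ^ (j - i) - 1) : ℕ) : ℤ) : ℚ) = ((n * s.den : ℤ) : ℚ) := by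
      rw [Int.cast_mul, Int.cast_mul, ← hs, Int.cast_natCast, Int.cast_natCast, this]
      ring
    exact_mod_cast h2
  have h3 : (s.den : ℤ) ∣ s.num * (p ^ i * (p ^ (j - i) - 1) : ℕ) := ⟨n, by rw [h1, mul_comm]⟩
  have h4 : IsCoprime (s.den : ℤ) s.num := by
    rw [Int.isCoprime_iff_gcd_eq_one, Int.gcd, Int.natAbs_natCast, Nat.gcd_comm]
    exact s.reduced
  have h5 : s.den ∣ p ^ i * (p ^ (j - i) - 1) := by exact_mod_cast h4.dvd_of_dvd_mul_left h3
  exact (Nat.Coprime.pow_right i hc).dvd_of_dvd_mul_left h5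

/-- Iterates `(x - 1)(y - 1) ≤ xy - 1` for `x, y ≥ 1`. The empty product would give `1 ≤ 0`. -/
theorem prod_pow_sub_one_le {ι : Type*} {p : ℕ} (hp : 1 ≤ p) (s : Finset ι) (hs : s.Nonempty)
    (a : ι → ℕ) : ∏ k ∈ s, (p ^ a k - 1) ≤ p ^ (∑ k ∈ s, a k) - 1 := by
  induction hs using Finset.Nonempty.cons_induction with
  | singleton k => simp
  | cons k s hk hs ih =>
    rw [Finset.prod_cons, Finset.sum_cons, pow_add]
    refine (Nat.mul_le_mul_left _ ih).trans ?_
    have h1 : 1 ≤ p ^ a k := Nat.one_le_pow _ _ hp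
    rw [Nat.sub_mul, Nat.mul_sub, one_mul, mul_one]
    have h2 : 1 ≤ p ^ ∑ k ∈ s, a k := Nat.one_le_pow _ _ hp
    have h3 := Nat.mul_le_mul_left (p ^ a k) h2
    omega

theorem newtonIndex_mem_ramificationSet {p : ℕ} (hp : 2 ≤ p) (hm : 1 ≤ m)
    (q : Fin m → RatFunc QBar) : newtonIndex p q ∈ ramificationSet p m := by
  classical
  set T := (hullSlopes (newtonPoints p q)).filter (fun s => Nat.gcd s.den p = 1) with hT
  have hidx : newtonIndex p q = T.lcm Rat.den := by
    rw [newtonIndex, Finset.filter_image, Finset.lcm_image, Function.id_comp]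
  -- Each slope `s` gets a segment, recorded by the exponents `ij` of `p` at its ends and by the
  -- heights `v`.
  have hex : ∀ s : T, ∃ ij : ℕ × ℕ, ∃ v : ℕ → ℤ, ij.1 < ij.2 ∧ ij.2 ≤ m ∧
      (s : ℚ) * ((p : ℚ) ^ ij.2 - (p : ℚ) ^ ij.1) = (v ij.2 - v ij.1 : ℤ) ∧
      (((p : ℤ) ^ ij.1, v ij.1) ∈ newtonPoints p q ∧ ((p : ℤ) ^ ij.2, v ij.2) ∈ newtonPoints p q) ∧
      ∀ c ∈ newtonPoints p q, (s : ℚ) * (c.1 - (p : ℚ) ^ ij.1) ≤ c.2 - v ij.1 := by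
    rintro ⟨s, hs⟩
    obtain ⟨a, ha, b, hb, hab, h1, h2⟩ := mem_hullSlopes.1 (Finset.mem_filter.1 hs).1
    obtain ⟨i, hi, -, rfl⟩ := mem_newtonPoints.1 ha
    obtain ⟨j, hj, -, rfl⟩ := mem_newtonPoints.1 hb
    refine ⟨(i, j), fun k => valZero (operatorCoeff q k), ?_, hj, ?_, ⟨ha, hb⟩, ?_⟩
    · simp only [] at hab
      exact (pow_lt_pow_iff_right₀ (by exact_mod_cast hp)).1 hab
    · push_cast at h1 ⊢; exact h1
    · intro c hc; simpa using h2 c hc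
  choose ij v hij hjm hslope hmem hsupp using hex
  have hdisj : Set.PairwiseDisjoint (Set.univ : Set T)
      (fun s => Finset.Ico (ij s).1 (ij s).2) := by
    -- Convexity: the supporting inequality of `s` at the left end of `t`, added to that of `t` at
    -- the right end of `s`, gives `(t - s)(p^(ij s).2 - p^(ij t).1) ≤ 0`.
    have hlt : ∀ s t : T, (s : ℚ) < t → (ij s).2 ≤ (ij t).1 := by
      intro s t hst
      have e1 := hsupp s _ (hmem t).1
      have e2 := hsupp t _ (hmem s).2
      have e3 := hslope s
      push_cast at e1 e2 e3
      have hle : ((p : ℚ) ^ (ij s).2) ≤ (p : ℚ) ^ (ij t).1 := by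
        by_contra hcon
        push Not at hcon
        have := mul_lt_mul_of_pos_right hst (sub_pos.2 hcon)
        linarith
      exact (pow_le_pow_iff_right₀ (by exact_mod_cast hp)).1 hle
    intro s _ t _ hst
    rw [Function.onFun, Finset.disjoint_left]
    intro k hk hk'
    rw [Finset.mem_Ico] at hk hk'
    rcases lt_or_gt_of_ne (fun h => hst (Subtype.ext h) : (s : ℚ) ≠ t) with h | h
    · have := hlt s t h; omega
    · have := hlt t s h; omega
  have hsum : ∑ s : T, ((ij s).2 - (ij s).1) ≤ m := by
    have h1 : (Finset.univ.biUnion fun s : T => Finset.Ico (ij s).1 (ij s).2) ⊆ Finset.range m := by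
      intro k hk
      obtain ⟨s, -, hs⟩ := Finset.mem_biUnion.1 hk
      have := hjm s
      rw [Finset.mem_Ico] at hs
      rw [Finset.mem_range]; omega
    have h2 := Finset.card_le_card h1
    rw [Finset.card_biUnion (fun s _ t _ h => hdisj trivial trivial h)] at h2
    simpa using h2
  have hdvd : ∀ s : T, (s : ℚ).den ∣ p ^ ((ij s).2 - (ij s).1) - 1 := fun s =>
    coprime_den_dvd (hij s) (hslope s) (by omega) (Finset.mem_filter.1 s.2).2
  have hpow : ∀ k : ℕ, 1 ≤ k → 1 ≤ p ^ k - 1 := by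
    intro k hk
    have := Nat.pow_le_pow_right (n := p) (by omega) hk
    rw [pow_one] at this
    omega
  rw [hidx]
  have hpos : 1 ≤ T.lcm Rat.den :=
    Nat.one_le_iff_ne_zero.2 (by
      rw [Ne, Finset.lcm_eq_zero_iff]
      rintro ⟨s, -, hs⟩
      exact s.den_nz hs)
  refine ⟨hpos, ?_, ?_⟩
  · rcases isEmpty_or_nonempty T with hE | hE
    · have : T = ∅ := Finset.isEmpty_coe_sort.1 hE
      rw [this, Finset.lcm_empty]
      exact hpow m hm
    · have h1 : T.lcm Rat.den ∣ ∏ s : T, (p ^ ((ij s).2 - (ij s).1) - 1) := by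
        refine Finset.lcm_dvd fun s hs => (hdvd ⟨s, hs⟩).trans ?_
        exact Finset.dvd_prod_of_mem (fun s : T => p ^ ((ij s).2 - (ij s).1) - 1)
          (Finset.mem_univ (⟨s, hs⟩ : T))
      have h2 : 0 < ∏ s : T, (p ^ ((ij s).2 - (ij s).1) - 1) :=
        Finset.prod_pos fun s _ => hpow _ (by have := hij s; omega)
      refine (Nat.le_of_dvd h2 h1).trans ((prod_pow_sub_one_le (by omega) _
        Finset.univ_nonempty _).trans ?_)
      exact Nat.sub_le_sub_right (Nat.pow_le_pow_right (by omega) hsum) 1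
  · have : T.lcm Rat.den ∣ ∏ s ∈ T, s.den := Finset.lcm_dvd_prod _ _
    exact Nat.Coprime.coprime_dvd_left this
      (Nat.Coprime.prod_left fun s hs => (Finset.mem_filter.1 hs).2)

end Newton

/-! ### Orders and supports of Hahn series -/

theorem order_embDomain {Γ Γ' R : Type*} [Zero R] [LinearOrder Γ] [PartialOrder Γ'] [Zero Γ]
    [Zero Γ'] (f : Γ ↪o Γ') {x : HahnSeries Γ R} (hx : x ≠ 0) :
    (HahnSeries.embDomain f x).order = f x.order := by
  have h0 : HahnSeries.embDomain f x ≠ 0 := fun h =>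
    hx (HahnSeries.embDomain_injective (f := f) (h.trans HahnSeries.embDomain_zero.symm))
  have h1 := HahnSeries.orderTop_embDomain (f := f) (x := x)
  rw [← HahnSeries.order_eq_orderTop_of_ne_zero h0,
    ← HahnSeries.order_eq_orderTop_of_ne_zero hx, WithTop.map_coe] at h1
  exact WithTop.coe_injective h1

/-- A minimal order attained by a single term would leave an uncancelled coefficient in the sum. -/
theorem exists_order_eq_of_sum_eq_zero {Γ R ι : Type*} [AddCommMonoid R] [LinearOrder Γ] [Zero Γ]
    (s : Finset ι) (t : ι → HahnSeries Γ R) (h : ∑ i ∈ s, t i = 0) {k : ι} (hk : k ∈ s)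
    (hk0 : t k ≠ 0) :
    ∃ i ∈ s, ∃ j ∈ s, i ≠ j ∧ t i ≠ 0 ∧ t j ≠ 0 ∧ (t i).order = (t j).order ∧
      ∀ l ∈ s, t l ≠ 0 → (t i).order ≤ (t l).order := by
  classical
  obtain ⟨i, hi, hmin⟩ := Finset.exists_min_image (s.filter (fun l => t l ≠ 0))
    (fun l => (t l).order) ⟨k, Finset.mem_filter.2 ⟨hk, hk0⟩⟩
  rw [Finset.mem_filter] at hi
  have hmin' : ∀ l ∈ s, t l ≠ 0 → (t i).order ≤ (t l).order := fun l hl hl0 =>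
    hmin l (Finset.mem_filter.2 ⟨hl, hl0⟩)
  by_contra hcon
  push Not at hcon
  have hlt : ∀ l ∈ s, l ≠ i → (t l).coeff (t i).order = 0 := by
    intro l hl hli
    by_cases hl0 : t l = 0
    · simp [hl0]
    · refine HahnSeries.coeff_eq_zero_of_lt_order (lt_of_le_of_ne (hmin' l hl hl0) fun heq => ?_)
      obtain ⟨r, hr, hr0, hr1⟩ := hcon i hi.1 l hl hli.symm hi.2 hl0 heq
      exact absurd (hmin' r hr hr0) (not_le.2 hr1)
  have h1 := congrArg (fun x => x.coeff (t i).order) h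
  simp only [HahnSeries.coeff_sum, HahnSeries.coeff_zero] at h1
  rw [Finset.sum_eq_single_of_mem i hi.1 hlt] at h1
  exact hi.2 (HahnSeries.coeff_order_eq_zero.1 h1)

/-- The part of a Hahn series with exponents in a given set. -/
noncomputable def restrictSupport {Γ R : Type*} [PartialOrder Γ] [Zero R] (s : Set Γ) (x : HahnSeries Γ R) :
    HahnSeries Γ R where
  coeff := s.indicator x.coeff
  isPWO_support' := x.isPWO_support.mono (by
    rw [Set.support_indicator]
    exact Set.inter_subset_right)

theorem coeff_restrictSupport {Γ R : Type*} [PartialOrder Γ] [Zero R] (s : Set Γ)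
    (x : HahnSeries Γ R) : (restrictSupport s x).coeff = s.indicator x.coeff := rfl

theorem restrictSupport_mem_exponentsIn (S : AddSubgroup ℚ) (x : HahnField) :
    restrictSupport (S : Set ℚ) x ∈ exponentsIn S := by
  rw [mem_exponentsIn]
  intro q hq
  by_contra h
  exact hq (Set.indicator_of_notMem h _)

theorem notMem_of_mem_support_sub_restrictSupport {S : AddSubgroup ℚ} {x : HahnField} {q : ℚ}
    (hq : q ∈ (x - restrictSupport (S : Set ℚ) x).support) : q ∉ S ∧ q ∈ x.support := by
  classical
  rw [HahnSeries.mem_support, HahnSeries.coeff_sub, coeff_restrictSupport,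
    Set.indicator_apply] at hq
  split_ifs at hq with h
  · simp at hq
  · exact ⟨h, by simpa using hq⟩

/-- The complement of a subgroup is stable under translation by its elements. -/
theorem notMem_of_mem_support_mul {S : AddSubgroup ℚ} {a x : HahnField} (ha : a ∈ exponentsIn S)
    (hx : ∀ q ∈ x.support, q ∉ S) : ∀ q ∈ (a * x).support, q ∉ S := by
  intro q hq hqS
  obtain ⟨u, hu, v, hv, rfl⟩ := HahnSeries.support_mul_subset hq
  exact hx v hv ((S.add_mem_cancel_left (mem_exponentsIn.1 ha u hu)).1 hqS)

theorem eq_zero_of_mem_exponentsIn {S : AddSubgroup ℚ} {x : HahnField} (hx : x ∈ exponentsIn S)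
    (hx' : ∀ q ∈ x.support, q ∉ S) : x = 0 := by
  rw [← HahnSeries.support_eq_empty_iff, Set.eq_empty_iff_forall_notMem]
  exact fun q hq => hx' q hq (mem_exponentsIn.1 hx q hq)

theorem notMem_of_mem_support_sum {S : Set ℚ} {ι : Type*} {s : Finset ι} {x : ι → HahnField}
    (hx : ∀ i ∈ s, ∀ q ∈ (x i).support, q ∉ S) : ∀ q ∈ (∑ i ∈ s, x i).support, q ∉ S := by
  intro q hq hqS
  rw [HahnSeries.mem_support, HahnSeries.coeff_sum] at hq
  refine hq (Finset.sum_eq_zero fun i hi => ?_)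
  by_contra h
  exact hx i hi q h hqS

/-! ### The Mahler operator on Hahn series -/

/-- Multiplication by `p` preserves the exponents in `(1/e)ℤ` that are not in `(1/d)ℤ`, if `e` is
prime to `p`. -/
theorem mem_zmultiples_of_pow_mul_mem {p d e : ℕ} (he : 1 ≤ e) (hde : d ∣ e) (hep : Nat.Coprime e p)
    (i : ℕ) {q : ℚ} (hq : ∃ n : ℤ, q = n / (e : ℚ))
    (h : (p : ℚ) ^ i * q ∈ AddSubgroup.zmultiples (1 / (d : ℚ))) :
    q ∈ AddSubgroup.zmultiples (1 / (d : ℚ)) := by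
  obtain ⟨n, rfl⟩ := hq
  obtain ⟨c, rfl⟩ := hde
  obtain ⟨k, hk⟩ := AddSubgroup.mem_zmultiples_iff.1 h
  have hd : (d : ℚ) ≠ 0 := by
    intro h0
    have : d = 0 := by exact_mod_cast h0
    simp [this] at he
  have hc : (c : ℚ) ≠ 0 := by
    intro h0
    have : c = 0 := by exact_mod_cast h0
    simp [this] at he
  have h1 : (p : ℤ) ^ i * n = k * c := by
    rw [zsmul_eq_mul] at hk
    push_cast at hk
    field_simp at hk
    have : ((p : ℚ) ^ i * n) = k * c := by linarith
    exact_mod_cast this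
  have h2 : IsCoprime (c : ℤ) ((p : ℤ) ^ i) :=
    ((Nat.isCoprime_iff_coprime.2 (Nat.Coprime.coprime_mul_left hep))).pow_right
  obtain ⟨l, rfl⟩ := h2.dvd_of_dvd_mul_left (⟨k, by rw [h1, mul_comm]⟩ : (c : ℤ) ∣ (p : ℤ) ^ i * n)
  refine AddSubgroup.mem_zmultiples_iff.2 ⟨l, ?_⟩
  rw [zsmul_eq_mul]
  push_cast
  field_simp

section Mahler

variable {p : ℕ} [NeZero p]

theorem mem_support_hahnMahler {x : HahnField} {q : ℚ} (hq : q ∈ (hahnMahler p x).support) :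
    ∃ s ∈ x.support, q = p * s := by
  obtain ⟨s, hs, rfl⟩ := HahnSeries.support_embDomain_subset hq
  exact ⟨s, hs, rfl⟩

theorem mem_support_hahnMahler_iterate {x : HahnField} (i : ℕ) {q : ℚ}
    (hq : q ∈ ((hahnMahler p)^[i] x).support) : ∃ s ∈ x.support, q = (p : ℚ) ^ i * s := by
  induction i generalizing q with
  | zero => exact ⟨q, hq, by simp⟩
  | succ i ih =>
    rw [Function.iterate_succ_apply'] at hq
    obtain ⟨s, hs, rfl⟩ := mem_support_hahnMahler hq
    obtain ⟨t, ht, rfl⟩ := ih hs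
    exact ⟨t, ht, by ring⟩

theorem hahnMahler_iterate_eq_zero {x : HahnField} (i : ℕ) :
    (hahnMahler p)^[i] x = 0 ↔ x = 0 := by
  refine ⟨fun h => ?_, fun h => by rw [h, iterate_map_zero]⟩
  exact (hahnMahler p).injective.iterate i (h.trans (iterate_map_zero (hahnMahler p) i).symm)

theorem order_hahnMahler_iterate {x : HahnField} (hx : x ≠ 0) (i : ℕ) :
    ((hahnMahler p)^[i] x).order = (p : ℚ) ^ i * x.order := by
  induction i with
  | zero => simp
  | succ i ih =>
    rw [Function.iterate_succ_apply']
    have h := order_embDomain (⟨⟨AddMonoidHom.mulLeft (p : ℚ),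
      mul_right_injective₀ (by exact_mod_cast NeZero.ne p)⟩,
      @fun _ _ => mul_le_mul_iff_right₀ (by exact_mod_cast NeZero.pos p)⟩ : ℚ ↪o ℚ)
      (x := (hahnMahler p)^[i] x) (by rwa [Ne, hahnMahler_iterate_eq_zero])
    refine h.trans ?_
    rw [ih]
    change (p : ℚ) * _ = _
    ring

theorem hahnMahler_iterate_mem_laurentRoot {d : ℕ} {x : HahnField} (hx : x ∈ laurentRoot d)
    (i : ℕ) : (hahnMahler p)^[i] x ∈ laurentRoot d := by
  rw [mem_laurentRoot] at hx ⊢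
  intro q hq
  obtain ⟨s, hs, rfl⟩ := mem_support_hahnMahler_iterate i hq
  obtain ⟨n, rfl⟩ := hx s hs
  exact ⟨p ^ i * n, by push_cast; ring⟩

/-- `φ_p` lowers the ramification index by its greatest common divisor with `p`. -/
theorem hahnMahler_mem_laurentRoot_div {e : ℕ} (he : 1 ≤ e) {x : HahnField}
    (hx : x ∈ laurentRoot e) : hahnMahler p x ∈ laurentRoot (e / Nat.gcd e p) := by
  rw [mem_laurentRoot] at hx ⊢
  intro q hq
  obtain ⟨s, hs, rfl⟩ := mem_support_hahnMahler hq
  obtain ⟨n, rfl⟩ := hx s hs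
  obtain ⟨a, ha⟩ := Nat.gcd_dvd_left e p
  obtain ⟨b, hb⟩ := Nat.gcd_dvd_right e p
  have hg : 0 < Nat.gcd e p := Nat.gcd_pos_of_pos_left _ he
  have h1 : e / Nat.gcd e p = a := Nat.div_eq_of_eq_mul_right hg ha
  have ha0 : a ≠ 0 := by
    rintro rfl
    omega
  refine ⟨b * n, ?_⟩
  rw [h1]
  have he' : (e : ℚ) = Nat.gcd e p * a := by exact_mod_cast ha
  have hp' : (p : ℚ) = Nat.gcd e p * b := by exact_mod_cast hb
  have hg' : ((Nat.gcd e p : ℕ) : ℚ) ≠ 0 := by exact_mod_cast hg.ne'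
  have ha' : (a : ℚ) ≠ 0 := by exact_mod_cast ha0
  rw [he', hp']
  push_cast
  field_simp

/-- Solving for `a 0 * f` shows that `f` is no more ramified than `φ f` and the right-hand side. So
a ramification index `e` can be replaced by `e / gcd(e, p)` until it is prime to `p`; being prime to
`p`, `d` continues to divide it. -/
theorem exists_coprime_laurentRoot {n d : ℕ} (hd : 1 ≤ d) (hdp : Nat.Coprime d p)
    {a : ℕ → HahnField} (ha : ∀ i, a i ∈ laurentRoot 1) (ha0 : a 0 ≠ 0) {f : HahnField}
    (hf : f ∈ puiseux)
    (h : ∑ i ∈ Finset.range (n + 1), a i * (hahnMahler p)^[i] f ∈ laurentRoot d) :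
    ∃ e, 1 ≤ e ∧ d ∣ e ∧ Nat.Coprime e p ∧ f ∈ laurentRoot e := by
  obtain ⟨k, hk, hfk⟩ := hf
  have main : ∀ e, 1 ≤ e → d ∣ e → f ∈ laurentRoot e →
      ∃ e, 1 ≤ e ∧ d ∣ e ∧ Nat.Coprime e p ∧ f ∈ laurentRoot e := by
    intro e
    induction e using Nat.strong_induction_on with
    | _ e ih =>
      intro he hde hfe
      by_cases hc : Nat.gcd e p = 1
      · exact ⟨e, he, hde, hc, hfe⟩
      have hg : 0 < Nat.gcd e p := Nat.gcd_pos_of_pos_left _ he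
      have hlt : e / Nat.gcd e p < e := Nat.div_lt_self he (by omega)
      have hpos : 1 ≤ e / Nat.gcd e p := Nat.div_pos (Nat.gcd_le_left _ he) hg
      have hdvd : d ∣ e / Nat.gcd e p := by
        have h1 : Nat.gcd e p * (e / Nat.gcd e p) = e := Nat.mul_div_cancel' (Nat.gcd_dvd_left e p)
        have h2 : Nat.Coprime d (Nat.gcd e p) := hdp.coprime_dvd_right (Nat.gcd_dvd_right e p)
        exact h2.dvd_of_dvd_mul_left (by rwa [h1])
      refine ih _ hlt hpos hdvd ?_
      have h1 := laurentRoot_mono hpos hdvd h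
      rw [Finset.sum_range_succ', Function.iterate_zero, id] at h1
      have h2 : ∑ i ∈ Finset.range n, a (i + 1) * (hahnMahler p)^[i + 1] f ∈
          laurentRoot (e / Nat.gcd e p) := by
        refine sum_mem fun i _ => mul_mem (laurentRoot_mono hpos (one_dvd _) (ha _)) ?_
        rw [Function.iterate_succ_apply]
        exact hahnMahler_iterate_mem_laurentRoot (hahnMahler_mem_laurentRoot_div he hfe) i
      have h3 := (add_mem_cancel_left h2).1 h1
      have h4 := mul_mem (inv_mem (laurentRoot_mono hpos (one_dvd _) (ha 0))) h3
      rwa [inv_mul_cancel_left₀ ha0] at h4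
  have hdk : 1 ≤ d * k := Nat.mul_pos hd hk
  exact main (d * k) hdk (dvd_mul_right d k) (laurentRoot_mono hdk (dvd_mul_left k d) hfk)

end Mahler

/-! ### Scalar Mahler equations -/

/-- The embedding of the rational functions into Hahn series: expansion at `0`. -/
noncomputable def ratToHahn : RatFunc QBar →+* HahnField := laurentToHahn.comp ratToLaurent

theorem ratToHahn_mem (g : RatFunc QBar) : ratToHahn g ∈ laurentRoot 1 := by
  rw [mem_laurentRoot]
  intro q hq
  obtain ⟨n, -, rfl⟩ := HahnSeries.support_embDomain_subset hq
  exact ⟨n, by simp⟩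

theorem order_ratToHahn {g : RatFunc QBar} (hg : g ≠ 0) : (ratToHahn g).order = (valZero g : ℚ) :=
  order_embDomain _ (x := ratToLaurent g) (by rwa [Ne, map_eq_zero])

theorem hahnSeries_C_mem (S : AddSubgroup ℚ) (c : QBar) : HahnSeries.C c ∈ exponentsIn S := by
  rw [mem_exponentsIn]
  intro q hq
  have : q = 0 := by simpa using HahnSeries.support_single_subset hq
  exact this ▸ S.zero_mem

theorem order_ratToHahn_mul_C {g : RatFunc QBar} (hg : g ≠ 0) {c : QBar} (hc : c ≠ 0) :
    (ratToHahn g * HahnSeries.C c).order = (valZero g : ℚ) := by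
  rw [HahnSeries.order_mul (by rwa [Ne, map_eq_zero]) (by rwa [Ne, map_eq_zero]),
    order_ratToHahn hg, HahnSeries.order_C, add_zero]

section Scalar

variable {p m : ℕ} [NeZero p]

/-- The order of a solution of a Mahler equation is the opposite of a slope of its Newton
polygon. -/
theorem neg_order_mem_hullSlopes (hp : 2 ≤ p) {q : Fin m → RatFunc QBar}
    (hq : operatorCoeff q 0 ≠ 0) {c : ℕ → QBar} (hc : ∀ i, c i ≠ 0) {f : HahnField} (hf : f ≠ 0)
    (h : ∑ i ∈ Finset.range (m + 1),
      ratToHahn (operatorCoeff q i) * HahnSeries.C (c i) * (hahnMahler p)^[i] f = 0) :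
    -f.order ∈ hullSlopes (newtonPoints p q) := by
  have hne : ∀ i, ratToHahn (operatorCoeff q i) * HahnSeries.C (c i) * (hahnMahler p)^[i] f ≠ 0 ↔
      operatorCoeff q i ≠ 0 := by
    intro i
    simp [hahnMahler_iterate_eq_zero, hf, hc i]
  have hord : ∀ i, operatorCoeff q i ≠ 0 →
      (ratToHahn (operatorCoeff q i) * HahnSeries.C (c i) * (hahnMahler p)^[i] f).order =
        valZero (operatorCoeff q i) + (p : ℚ) ^ i * f.order := by
    intro i hi
    rw [HahnSeries.order_mul (mul_ne_zero (by rwa [Ne, map_eq_zero]) (by simp [hc i]))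
      (by rwa [Ne, hahnMahler_iterate_eq_zero]), order_ratToHahn_mul_C hi (hc i),
      order_hahnMahler_iterate hf]
  obtain ⟨i, hi, j, hj, hij, hi0, hj0, heq, hmin⟩ := exists_order_eq_of_sum_eq_zero _ _ h
    (Finset.mem_range.2 (Nat.succ_pos m)) ((hne 0).2 hq)
  rw [hne] at hi0 hj0
  rw [hord i hi0, hord j hj0] at heq
  rw [Finset.mem_range, Nat.lt_succ_iff] at hi hj
  have hmin' : ∀ l ≤ m, operatorCoeff q l ≠ 0 →
      (valZero (operatorCoeff q i) : ℚ) + (p : ℚ) ^ i * f.order ≤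
        valZero (operatorCoeff q l) + (p : ℚ) ^ l * f.order := by
    intro l hl hl0
    have := hmin l (Finset.mem_range.2 (Nat.lt_succ_of_le hl)) ((hne l).2 hl0)
    rwa [hord i hi0, hord l hl0] at this
  have hlt : ∀ {i j : ℕ}, i < j → (p : ℤ) ^ i < (p : ℤ) ^ j := fun h =>
    pow_lt_pow_right₀ (by exact_mod_cast hp) h
  rw [mem_hullSlopes]
  rcases lt_or_gt_of_ne hij with hlt' | hlt'
  · refine ⟨_, mem_newtonPoints.2 ⟨i, hi, hi0, rfl⟩, _, mem_newtonPoints.2 ⟨j, hj, hj0, rfl⟩,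
      hlt hlt', by push_cast; linarith, fun a ha => ?_⟩
    obtain ⟨l, hl, hl0, rfl⟩ := mem_newtonPoints.1 ha
    have := hmin' l hl hl0
    push_cast
    linarith
  · refine ⟨_, mem_newtonPoints.2 ⟨j, hj, hj0, rfl⟩, _, mem_newtonPoints.2 ⟨i, hi, hi0, rfl⟩,
      hlt hlt', by push_cast; linarith, fun a ha => ?_⟩
    obtain ⟨l, hl, hl0, rfl⟩ := mem_newtonPoints.1 ha
    have := hmin' l hl hl0
    push_cast
    linarith

/-- The part `f - f₀` of `f` with exponents outside `(1/d)ℤ` solves the homogeneous equation, and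
the Newton polygon forbids its order. The inhomogeneous form is what the induction on generalized
eigenvectors requires. -/
theorem mem_laurentRoot_newtonIndex (hp : 2 ≤ p) (hm : 1 ≤ m) {q : Fin m → RatFunc QBar}
    (hq : operatorCoeff q 0 ≠ 0) {c : ℕ → QBar} (hc : ∀ i, c i ≠ 0) {f : HahnField}
    (hf : f ∈ puiseux)
    (h : ∑ i ∈ Finset.range (m + 1), ratToHahn (operatorCoeff q i) * HahnSeries.C (c i) *
      (hahnMahler p)^[i] f ∈ laurentRoot (newtonIndex p q)) :
    f ∈ laurentRoot (newtonIndex p q) := by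
  set d := newtonIndex p q with hd
  obtain ⟨hd1, -, hdp⟩ := newtonIndex_mem_ramificationSet hp hm q
  have ha : ∀ e i, 1 ≤ e →
      ratToHahn (operatorCoeff q i) * HahnSeries.C (c i) ∈ laurentRoot e := fun e i he =>
    mul_mem (laurentRoot_mono he (one_dvd _) (ratToHahn_mem _)) (hahnSeries_C_mem _ _)
  obtain ⟨e, he, hde, hep, hfe⟩ := exists_coprime_laurentRoot hd1 hdp
    (a := fun i => ratToHahn (operatorCoeff q i) * HahnSeries.C (c i)) (fun i => ha 1 i le_rfl)
    (by simp [hq, hc 0]) hf h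
  set S := AddSubgroup.zmultiples (1 / (d : ℚ)) with hS
  set f₀ := restrictSupport (S : Set ℚ) f with hf₀
  have hf₀d : f₀ ∈ laurentRoot d := restrictSupport_mem_exponentsIn S f
  have hsupp : ∀ s ∈ (f - f₀).support, s ∉ S ∧ s ∈ f.support := fun s hs =>
    notMem_of_mem_support_sub_restrictSupport hs
  by_contra hcon
  have hne : f - f₀ ≠ 0 := fun h0 => hcon (by rwa [sub_eq_zero.1 h0])
  -- The sum has exponents in `(1/d)ℤ` by difference with the one for `f₀`, and outside `(1/d)ℤ`
  -- because `e` is prime to `p`.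
  have hzero : ∑ i ∈ Finset.range (m + 1), ratToHahn (operatorCoeff q i) * HahnSeries.C (c i) *
      (hahnMahler p)^[i] (f - f₀) = 0 := by
    refine eq_zero_of_mem_exponentsIn (S := S) ?_ ?_
    · have h1 : ∑ i ∈ Finset.range (m + 1), ratToHahn (operatorCoeff q i) * HahnSeries.C (c i) *
          (hahnMahler p)^[i] f₀ ∈ laurentRoot d :=
        sum_mem fun i _ => mul_mem (ha d i hd1) (hahnMahler_iterate_mem_laurentRoot hf₀d i)
      have h2 := sub_mem h h1
      rw [← Finset.sum_sub_distrib] at h2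
      simp only [iterate_map_sub, mul_sub]
      exact h2
    · refine notMem_of_mem_support_sum fun i _ => notMem_of_mem_support_mul (ha d i hd1) ?_
      intro s hs hsS
      obtain ⟨t, ht, rfl⟩ := mem_support_hahnMahler_iterate i hs
      exact (hsupp t ht).1 (mem_zmultiples_of_pow_mul_mem he hde hep i
        (mem_laurentRoot.1 hfe t (hsupp t ht).2) hsS)
  have hmem : (f - f₀).order ∈ (f - f₀).support := by
    rwa [HahnSeries.mem_support, Ne, HahnSeries.coeff_order_eq_zero]
  have hslope := neg_order_mem_hullSlopes hp hq hc hne hzero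
  set v := (f - f₀).order with hv
  have hve : v.den ∣ e := by
    obtain ⟨n, hn⟩ := mem_laurentRoot.1 hfe v (hsupp v hmem).2
    rw [hn]
    exact_mod_cast Rat.divInt_eq_div n e ▸ Rat.den_dvd n e
  -- As a divisor of `e`, the denominator of the slope `-v` is prime to `p`, so it is one of those
  -- whose lcm is `d`.
  have hvd : v.den ∣ d := by
    have h1 : v.den ∈ ((hullSlopes (newtonPoints p q)).image Rat.den).filter
        (fun n => Nat.gcd n p = 1) :=
      Finset.mem_filter.2 ⟨Finset.mem_image.2 ⟨-v, hslope, Rat.den_neg_eq_den v⟩,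
        Nat.Coprime.coprime_dvd_left hve hep⟩
    exact Finset.dvd_lcm (f := id) h1
  refine (hsupp v hmem).1 (AddSubgroup.mem_zmultiples_iff.2 ?_)
  obtain ⟨k, hk⟩ := hvd
  refine ⟨v.num * k, ?_⟩
  rw [zsmul_eq_mul, hk]
  have hk0 : (k : ℚ) ≠ 0 := by
    intro h0
    have : k = 0 := by exact_mod_cast h0
    simp [this] at hk
    omega
  have hden : (v.den : ℚ) ≠ 0 := by exact_mod_cast v.den_nz
  push_cast
  rw [← Rat.mul_den_eq_num v]
  field_simp

end Scalar

open Matrix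
open scoped RatFunc

/-! ### Systems of Mahler equations with constant coefficients -/

theorem ratToHahn_C (c : QBar) : ratToHahn (RatFunc.C c) = HahnSeries.C c := by
  have h : ratToLaurent (RatFunc.C c) = HahnSeries.C c := by
    have h1 := RatFunc.coe_coe (Polynomial.C c)
    rw [Polynomial.coe_C, PowerSeries.coe_C] at h1
    rw [h1, RatFunc.coePolynomial_eq_algebraMap, RatFunc.algebraMap_C]
    rfl
  rw [ratToHahn, RingHom.comp_apply, h]
  refine (HahnSeries.embDomain_single).trans ?_
  simp

theorem ratToHahn_X : ratToHahn RatFunc.X = HahnSeries.single (1 : ℚ) 1 := by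
  rw [ratToHahn, RingHom.comp_apply, ratToLaurent, RatFunc.coe_X]
  refine (HahnSeries.embDomain_single).trans ?_
  simp

section

variable {p : ℕ} [NeZero p]

theorem hahnMahler_single (q : ℚ) (c : QBar) :
    hahnMahler p (HahnSeries.single q c) = HahnSeries.single (p * q) c :=
  HahnSeries.embDomain_single

theorem hahnMahler_C (c : QBar) : hahnMahler p (HahnSeries.C c) = HahnSeries.C c := by
  rw [HahnSeries.C_apply, hahnMahler_single, mul_zero]

theorem hahnMahler_iterate_C_mul (i : ℕ) (c : QBar) (x : HahnField) :
    (hahnMahler p)^[i] (HahnSeries.C c * x) = HahnSeries.C c * (hahnMahler p)^[i] x := by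
  induction i with
  | zero => rfl
  | succ i ih => rw [Function.iterate_succ_apply', Function.iterate_succ_apply', ih, map_mul,
      hahnMahler_C]

theorem ratMahler_algebraMap (g : Polynomial QBar) :
    ratMahler p (algebraMap _ _ g) = algebraMap _ _ (Polynomial.expand QBar p g) := by
  rw [ratMahler, RatFunc.coe_mapRingHom_eq_coe_map, RatFunc.map_apply]
  simp

theorem hahnMahler_ratToHahn (g : RatFunc QBar) :
    hahnMahler p (ratToHahn g) = ratToHahn (ratMahler p g) := by
  suffices h : (hahnMahler p).comp ratToHahn = ratToHahn.comp (ratMahler p) from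
    RingHom.congr_fun h g
  refine IsLocalization.ringHom_ext (nonZeroDivisors (Polynomial QBar)) ?_
  refine Polynomial.ringHom_ext (fun c => ?_) ?_
  · simp only [RingHom.comp_apply]
    rw [ratMahler_algebraMap, Polynomial.expand_C, RatFunc.algebraMap_C, ratToHahn_C, hahnMahler_C]
  · simp only [RingHom.comp_apply]
    rw [ratMahler_algebraMap, Polynomial.expand_X, map_pow, map_pow, RatFunc.algebraMap_X,
      ratToHahn_X, hahnMahler_single, HahnSeries.single_pow]
    simp

variable {m : ℕ}

/-- The vectors with the desired property form a subspace, so generalized eigenvectors suffice; for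
these the twisted equation becomes scalar, by induction on depth. -/
theorem linearMap_mem_laurentRoot_newtonIndex (hp : 2 ≤ p) (hm : 1 ≤ m) {q : Fin m → RatFunc QBar}
    (hq : operatorCoeff q 0 ≠ 0) {V : Type*} [AddCommGroup V] [Module QBar V]
    [FiniteDimensional QBar V] {T : Module.End QBar V} (hT : Function.Injective T)
    (l : V →ₗ[QBar] HahnField) (hl : ∀ v, l v ∈ puiseux)
    (h : ∀ v, ∑ i ∈ Finset.range (m + 1),
      ratToHahn (operatorCoeff q i) * (hahnMahler p)^[i] (l ((T ^ i) v)) = 0) (v : V) :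
    l v ∈ laurentRoot (newtonIndex p q) := by
  have hd1 : 1 ≤ newtonIndex p q := (newtonIndex_mem_ramificationSet hp hm q).1
  let W : Submodule QBar V :=
    { carrier := {v | l v ∈ laurentRoot (newtonIndex p q)}
      add_mem' := fun {a b} ha hb => by
        change l (a + b) ∈ laurentRoot (newtonIndex p q)
        rw [map_add]
        exact add_mem ha hb
      zero_mem' := by
        change l 0 ∈ laurentRoot (newtonIndex p q)
        rw [map_zero]
        exact zero_mem _
      smul_mem' := fun c a ha => by
        change l (c • a) ∈ laurentRoot (newtonIndex p q)
        rw [map_smul, ← HahnSeries.C_mul_eq_smul]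
        exact mul_mem (hahnSeries_C_mem _ _) ha }
  have : IsAlgClosed QBar := (algebraicClosure.isAlgClosure ℚ ℂ).isAlgClosed
  suffices hW : ∀ μ, T.maxGenEigenspace μ ≤ W by
    have h1 : (⊤ : Submodule QBar V) ≤ W := by
      rw [← Module.End.iSup_maxGenEigenspace_eq_top T]
      exact iSup_le hW
    exact h1 (Submodule.mem_top (x := v))
  intro μ
  -- The eigenvalue `0` does not occur for injective `T`; otherwise the coefficients `μ ^ i` of the
  -- scalar equation would vanish.
  by_cases hμ : μ = 0
  · intro v hv
    rw [Module.End.mem_maxGenEigenspace] at hv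
    obtain ⟨k, hk⟩ := hv
    rw [hμ, zero_smul, sub_zero, Module.End.pow_apply] at hk
    have hv0 : v = 0 := hT.iterate k (hk.trans (iterate_map_zero T k).symm)
    rw [hv0]
    exact W.zero_mem
  have hk : ∀ k : ℕ, T.genEigenspace μ k ≤ W := by
    intro k
    induction k with
    | zero =>
      rw [Nat.cast_zero, Module.End.genEigenspace_zero]
      exact bot_le
    | succ k ih =>
      intro v hv
      have hN : T v - μ • v ∈ T.genEigenspace μ k := by
        rw [Module.End.mem_genEigenspace_nat, LinearMap.mem_ker] at hv ⊢
        rw [pow_succ, Module.End.mul_apply] at hv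
        simpa using hv
      have hpow : ∀ i : ℕ, (T ^ i) v - μ ^ i • v ∈ T.genEigenspace μ k := by
        intro i
        induction i with
        | zero => simp
        | succ i ihi =>
          have h1 := Module.End.mapsTo_genEigenspace_of_comm (Commute.refl T) μ k ihi
          have h2 := Submodule.smul_mem _ (μ ^ i) hN
          have h3 := add_mem h1 h2
          convert h3 using 1
          rw [pow_succ', Module.End.mul_apply, map_sub, map_smul, smul_sub, smul_smul, ← pow_succ]
          abel
      refine mem_laurentRoot_newtonIndex hp hm hq (c := fun i => μ ^ i)
        (fun i => pow_ne_zero i hμ) (hl v) ?_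
      -- The inhomogeneous term is, up to sign, the contribution of the differences `T^i v - μ^i v`,
      -- which have smaller depth.
      have h1 : ∑ i ∈ Finset.range (m + 1), ratToHahn (operatorCoeff q i) *
          (hahnMahler p)^[i] (l ((T ^ i) v - μ ^ i • v)) ∈ laurentRoot (newtonIndex p q) :=
        sum_mem fun i _ => mul_mem (laurentRoot_mono hd1 (one_dvd _) (ratToHahn_mem _))
          (hahnMahler_iterate_mem_laurentRoot (ih (hpow i)) i)
      have h2 := neg_mem h1
      have h3 := h v
      convert h2 using 1
      rw [← zero_sub, ← h3, ← Finset.sum_sub_distrib]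
      refine Finset.sum_congr rfl fun i _ => ?_
      rw [map_sub, map_smul, iterate_map_sub, ← HahnSeries.C_mul_eq_smul,
        hahnMahler_iterate_C_mul]
      ring
  intro v hv
  rw [Module.End.mem_maxGenEigenspace] at hv
  obtain ⟨k, hkv⟩ := hv
  exact hk k (by rwa [Module.End.mem_genEigenspace_nat, LinearMap.mem_ker])

/-! ### Gauge transformations -/

/-- The inverse needs no separate check: over a subfield, a nonzero determinant is enough. -/
theorem inGLLaurentRoot_of_forall_mem {d : ℕ} {Ψ : GeneralLinearGroup (Fin m) PuiseuxField}
    (h : ∀ i j, ((Ψ.val i j : PuiseuxField) : HahnField) ∈ laurentRoot d) :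
    InGLLaurentRoot d Ψ := by
  let M : Matrix (Fin m) (Fin m) (laurentRoot d) := Matrix.of fun i j => ⟨_, h i j⟩
  have hM : (laurentRoot d).subtype.mapMatrix M = puiseux.subtype.mapMatrix Ψ.val := by
    ext i j
    rfl
  have hdet : M.det ≠ 0 := by
    intro h0
    have h1 := congrArg Matrix.det hM
    rw [← RingHom.map_det, ← RingHom.map_det, h0, map_zero] at h1
    exact (Ψ.isUnit.map (Matrix.detMonoidHom)).ne_zero
      ((map_eq_zero puiseux.subtype).1 h1.symm)
  refine ⟨GeneralLinearGroup.mkOfDetNeZero M hdet, ?_⟩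
  ext i j
  rfl

theorem operatorCoeff_zero_ne_zero (hm : 1 ≤ m) {q : Fin m → RatFunc QBar}
    (hq : IsUnit (companion q)) : operatorCoeff q 0 ≠ 0 := by
  intro h0
  have hm' : 0 < m := hm
  simp only [operatorCoeff, hm', dif_pos] at h0
  refine ((Matrix.isUnit_iff_isUnit_det _).1 hq).ne_zero
    (Matrix.det_eq_zero_of_column_eq_zero (⟨0, hm'⟩ : Fin m) fun i => ?_)
  simp only [companion, Matrix.of_apply]
  split_ifs with h1 h2
  · exact h0
  · exact h2.elim
  · rfl

theorem IsConstantGauge.exists_mul_eq {A : GeneralLinearGroup (Fin m) (RatFunc QBar)}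
    {Ψ : GeneralLinearGroup (Fin m) PuiseuxField} (h : IsConstantGauge p A Ψ) :
    ∃ Λ : Matrix (Fin m) (Fin m) QBar, IsUnit Λ ∧
      ratToHahn.mapMatrix A.val * puiseux.subtype.mapMatrix Ψ.val =
        (hahnMahler p).mapMatrix (puiseux.subtype.mapMatrix Ψ.val) *
          (HahnSeries.C : QBar →+* HahnField).mapMatrix Λ := by
  obtain ⟨Λ, hΛ⟩ := h
  set G := (GeneralLinearGroup.map (mahler p) Ψ)⁻¹ * GeneralLinearGroup.map ratToPuiseux A * Ψ
    with hG
  have hmul : GeneralLinearGroup.map ratToPuiseux A * Ψ =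
      GeneralLinearGroup.map (mahler p) Ψ * G := by
    rw [hG]; group
  refine ⟨Λ, ?_, ?_⟩
  · rw [Matrix.isUnit_iff_isUnit_det, isUnit_iff_ne_zero]
    intro h0
    have h1 := (G.isUnit.map (Matrix.detMonoidHom)).ne_zero
    refine h1 ?_
    change G.val.det = 0
    rw [hΛ]
    change (constToPuiseux.mapMatrix Λ).det = 0
    rw [← RingHom.map_det, h0, map_zero]
  · have h1 := congrArg (fun M : GeneralLinearGroup (Fin m) PuiseuxField =>
      puiseux.subtype.mapMatrix M.val) hmul
    simp only [Units.val_mul, map_mul] at h1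
    refine h1.trans ?_
    rw [hΛ]
    congr 1
    ext i j : 1
    exact ratToHahn_C _

/-- Multiplication of a matrix by constant vectors. -/
noncomputable def constMulVec (Θ : Matrix (Fin m) (Fin m) HahnField) :
    (Fin m → QBar) →ₗ[QBar] (Fin m → HahnField) where
  toFun v := Θ *ᵥ fun j => HahnSeries.C (v j)
  map_add' v w := by
    rw [← Matrix.mulVec_add]
    congr 1
    ext j : 1
    simp
  map_smul' c v := by
    funext i
    simp only [RingHom.id_apply, Pi.smul_apply, Matrix.mulVec, dotProduct]
    rw [← HahnSeries.C_mul_eq_smul, Finset.mul_sum]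
    refine Finset.sum_congr rfl fun j _ => ?_
    rw [smul_eq_mul, map_mul, mul_left_comm]

theorem hahnMahler_constMulVec (Θ : Matrix (Fin m) (Fin m) HahnField)
    (Λ : Matrix (Fin m) (Fin m) QBar) (v : Fin m → QBar) (i : Fin m) :
    hahnMahler p (constMulVec Θ (Λ *ᵥ v) i) =
      (((hahnMahler p).mapMatrix Θ * (HahnSeries.C : QBar →+* HahnField).mapMatrix Λ) *ᵥ
        fun j => HahnSeries.C (v j)) i := by
  have h1 : constMulVec Θ (Λ *ᵥ v) i = (Θ *ᵥ fun j => HahnSeries.C ((Λ *ᵥ v) j)) i := rfl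
  rw [h1, RingHom.map_mulVec, ← Matrix.mulVec_mulVec]
  refine congrFun (congrArg _ (funext fun j => ?_)) i
  rw [Function.comp_apply, hahnMahler_C]
  exact RingHom.map_mulVec _ _ _ _

/-- Passing to `Θ = PΨ` turns the system into a companion one, governed by its first row; since `P`
is rational, nothing is lost on the way back to `Ψ`. -/
theorem IsConstantGauge.inGLLaurentRoot (hp : 2 ≤ p) (hm : 1 ≤ m)
    {A : GeneralLinearGroup (Fin m) (RatFunc QBar)}
    {Ψ : GeneralLinearGroup (Fin m) PuiseuxField} (h : IsConstantGauge p A Ψ)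
    {P : Matrix (Fin m) (Fin m) (RatFunc QBar)} (hP : IsUnit P) {q : Fin m → RatFunc QBar}
    (hPq : P.map (ratMahler p) * A.val * P⁻¹ = companion q) :
    InGLLaurentRoot (newtonIndex p q) Ψ := by
  have hd1 : 1 ≤ newtonIndex p q := (newtonIndex_mem_ramificationSet hp hm q).1
  have hPdet : IsUnit P.det := (Matrix.isUnit_iff_isUnit_det _).1 hP
  have hcomp : IsUnit (companion q) := by
    rw [← hPq]
    refine (IsUnit.mul ?_ A.isUnit).mul ((Matrix.isUnit_nonsing_inv_iff).2 hP)
    exact hP.map (ratMahler p).mapMatrix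
  have hq := operatorCoeff_zero_ne_zero hm hcomp
  obtain ⟨Λ, hΛ, hmul⟩ := h.exists_mul_eq
  set ψ := puiseux.subtype.mapMatrix Ψ.val with hψ
  set Θ := ratToHahn.mapMatrix P * ψ with hΘ
  have hΘeq : (hahnMahler p).mapMatrix Θ * (HahnSeries.C : QBar →+* HahnField).mapMatrix Λ =
      ratToHahn.mapMatrix (companion q) * Θ := by
    have h1 : (hahnMahler p).mapMatrix (ratToHahn.mapMatrix P) =
        ratToHahn.mapMatrix (P.map (ratMahler p)) := by
      ext i j : 1
      exact hahnMahler_ratToHahn _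
    have h2 : companion q * P = P.map (ratMahler p) * A.val := by
      rw [← hPq, Matrix.nonsing_inv_mul_cancel_right _ _ hPdet]
    rw [hΘ, map_mul, mul_assoc, ← hmul, h1, ← mul_assoc, ← map_mul, ← h2, map_mul, mul_assoc]
  set l := constMulVec Θ with hl'
  have hl : ∀ v, l v = Θ *ᵥ fun j => HahnSeries.C (v j) := fun v => rfl
  have hstep : ∀ v i, hahnMahler p (l (Λ *ᵥ v) i) =
      (ratToHahn.mapMatrix (companion q) *ᵥ l v) i := by
    intro v i
    rw [hl', hahnMahler_constMulVec, hΘeq, ← Matrix.mulVec_mulVec]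
    rfl
  set T := Matrix.toLin' Λ with hT
  have hTinj : Function.Injective T := Matrix.mulVec_injective_iff_isUnit.2 hΛ
  -- The ones above the diagonal make each entry φ of the previous one, with `v` replaced by `T v`.
  have hrow : ∀ i (hi : i < m) v, l v ⟨i, hi⟩ = (hahnMahler p)^[i] (l ((T ^ i) v) ⟨0, hm⟩) := by
    intro i
    induction i with
    | zero => intro hi v; rfl
    | succ i ih =>
      intro hi v
      have h1 := hstep v ⟨i, by omega⟩
      rw [Matrix.mulVec, dotProduct, Finset.sum_eq_single ⟨i + 1, hi⟩] at h1
      · have h2 : companion q ⟨i, by omega⟩ ⟨i + 1, hi⟩ = 1 := by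
          simp [companion, hi.ne]
        rw [RingHom.mapMatrix_apply, Matrix.map_apply, h2, map_one, one_mul] at h1
        rw [← h1, ih (by omega), Function.iterate_succ_apply', pow_succ, Module.End.mul_apply]
        rfl
      · intro j _ hj
        have h2 : companion q ⟨i, by omega⟩ j = 0 := by
          have : (j : ℕ) ≠ i + 1 := fun h => hj (Fin.ext h)
          simp [companion, hi.ne, this]
        rw [RingHom.mapMatrix_apply, Matrix.map_apply, h2, map_zero, zero_mul]
      · simp
  have hlast : ∀ v, ∑ i ∈ Finset.range (m + 1), ratToHahn (operatorCoeff q i) *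
      (hahnMahler p)^[i] (l ((T ^ i) v) ⟨0, hm⟩) = 0 := by
    intro v
    have h1 := hstep v ⟨m - 1, by omega⟩
    rw [hrow, ← Function.iterate_succ_apply' (hahnMahler p), Matrix.mulVec, dotProduct] at h1
    rw [Finset.sum_range_succ, Finset.sum_range]
    have h2 : ∀ x : HahnField, ratToHahn (operatorCoeff q m) * x = -x := fun x => by
      have : ratToHahn (operatorCoeff q m) = -1 := by simp [operatorCoeff]
      rw [this]
      exact neg_one_mul x
    rw [h2, add_neg_eq_zero]
    have hm1 : (m - 1).succ = m := Nat.sub_add_cancel hm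
    have h3 : (T ^ (m - 1)) (Λ *ᵥ v) = (T ^ m) v := by
      have h4 : T ^ m = T ^ (m - 1).succ := congrArg (T ^ ·) hm1.symm
      rw [h4, pow_succ, Module.End.mul_apply]
      rfl
    rw [h3, hm1] at h1
    rw [h1]
    refine Finset.sum_congr rfl fun j _ => ?_
    rw [← hrow j j.2, RingHom.mapMatrix_apply, Matrix.map_apply]
    congr 2
    simp [companion, operatorCoeff, Nat.sub_add_cancel hm]
  have hPui : ∀ v, l v ⟨0, hm⟩ ∈ puiseux := by
    intro v
    have hmem : ∀ c : QBar, HahnSeries.C c ∈ puiseux := fun c =>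
      ⟨1, le_rfl, hahnSeries_C_mem _ c⟩
    rw [hl, Matrix.mulVec, dotProduct]
    refine sum_mem fun j _ => mul_mem ?_ (hmem _)
    rw [hΘ, Matrix.mul_apply]
    exact sum_mem fun k _ => mul_mem ⟨1, le_rfl, ratToHahn_mem _⟩ (Ψ.val k j).2
  have h0 := linearMap_mem_laurentRoot_newtonIndex hp hm hq hTinj
    ((LinearMap.proj (⟨0, hm⟩ : Fin m)).comp l) hPui hlast
  have hΘmem : ∀ i j, Θ i j ∈ laurentRoot (newtonIndex p q) := by
    intro i j
    have h1 : Θ i j = l (Pi.single j 1) i := by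
      rw [hl, Matrix.mulVec, dotProduct, Finset.sum_eq_single j]
      · simp
      · intro k _ hk
        simp [hk]
      · simp
    rw [h1, hrow i i.2]
    exact hahnMahler_iterate_mem_laurentRoot (h0 _) _
  refine inGLLaurentRoot_of_forall_mem fun i j => ?_
  have h1 : ψ = ratToHahn.mapMatrix P⁻¹ * Θ := by
    rw [hΘ, ← mul_assoc, ← map_mul, Matrix.nonsing_inv_mul _ hPdet, map_one, one_mul]
  change ψ i j ∈ _
  rw [h1, Matrix.mul_apply]
  exact sum_mem fun k _ => mul_mem (laurentRoot_mono hd1 (one_dvd _) (ratToHahn_mem _)) (hΘmem k j)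

end

/-! ### Values of rational functions -/

/-- The ring of the rational functions that are regular at `w`. -/
noncomputable def regularAt (w : QBar) : Subring (RatFunc QBar) where
  carrier := {f | f.denom.eval w ≠ 0}
  mul_mem' {f g} hf hg := fun h => by
    have h1 := Polynomial.eval_dvd (x := w) (RatFunc.denom_mul_dvd f g)
    rw [h, zero_dvd_iff, Polynomial.eval_mul] at h1
    exact mul_ne_zero hf hg h1
  one_mem' := by
    change Polynomial.eval w (RatFunc.denom 1) ≠ 0
    simp
  add_mem' {f g} hf hg := fun h => by
    have h1 := Polynomial.eval_dvd (x := w) (RatFunc.denom_add_dvd f g)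
    rw [h, zero_dvd_iff, Polynomial.eval_mul] at h1
    exact mul_ne_zero hf hg h1
  zero_mem' := by
    change Polynomial.eval w (RatFunc.denom 0) ≠ 0
    simp
  neg_mem' {f} hf := by
    intro h
    have h1 := RatFunc.denom_mul_dvd (algebraMap (Polynomial QBar) (RatFunc QBar) (-1)) f
    rw [RatFunc.denom_algebraMap, one_mul, map_neg, map_one, neg_one_mul] at h1
    have h2 := Polynomial.eval_dvd (x := w) h1
    rw [h, zero_dvd_iff] at h2
    exact hf h2

theorem mem_regularAt {w : QBar} {f : RatFunc QBar} : f ∈ regularAt w ↔ f.denom.eval w ≠ 0 :=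
  Iff.rfl

/-- Evaluation at `w`. -/
noncomputable def evalHom (w : QBar) : regularAt w →+* QBar where
  toFun f := RatFunc.eval (RingHom.id QBar) w f
  map_one' := RatFunc.eval_one _ _
  map_zero' := RatFunc.eval_zero _ _
  map_mul' f g := RatFunc.eval_mul _ _ f.2 g.2
  map_add' f g := RatFunc.eval_add _ _ f.2 g.2

variable {p m : ℕ} [NeZero p]

/-- The denominator of `f(z^p)` divides the expanded denominator of `f`, which does not vanish at
`w`; the values are compared after multiplying by the latter. -/
theorem ratMahler_regularAt {w : QBar} {f : RatFunc QBar} (hf : f ∈ regularAt (w ^ p)) :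
    ratMahler p f ∈ regularAt w ∧ RatFunc.eval (RingHom.id QBar) w (ratMahler p f) =
      RatFunc.eval (RingHom.id QBar) (w ^ p) f := by
  have h1 : ratMahler p f = algebraMap _ _ (Polynomial.expand QBar p f.num) /
      algebraMap _ _ (Polynomial.expand QBar p f.denom) := by
    rw [ratMahler, RatFunc.coe_mapRingHom_eq_coe_map, RatFunc.map_apply]
  have hden : (Polynomial.expand QBar p f.denom).eval w ≠ 0 := by
    rw [Polynomial.expand_eval]
    exact hf
  have hmem : ratMahler p f ∈ regularAt w := by
    intro h
    rw [h1] at h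
    have h2 := Polynomial.eval_dvd (x := w) (RatFunc.denom_div_dvd
      (Polynomial.expand QBar p f.num) (Polynomial.expand QBar p f.denom))
    rw [h, zero_dvd_iff] at h2
    exact hden h2
  refine ⟨hmem, ?_⟩
  have hpoly : ∀ g : Polynomial QBar, algebraMap _ (RatFunc QBar) g ∈ regularAt w := by
    intro g
    rw [mem_regularAt, RatFunc.denom_algebraMap]
    simp
  have hmul : ratMahler p f * algebraMap _ _ (Polynomial.expand QBar p f.denom) =
      algebraMap _ _ (Polynomial.expand QBar p f.num) := by
    rw [h1, div_mul_cancel₀]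
    refine RatFunc.algebraMap_ne_zero fun h => ?_
    rw [h] at hden
    simp at hden
  have h2 := (RatFunc.eval_mul (RingHom.id QBar) w (x := ratMahler p f)
    (y := algebraMap _ _ (Polynomial.expand QBar p f.denom)) hmem (hpoly _)).symm
  rw [hmul, RatFunc.eval_algebraMap, RatFunc.eval_algebraMap] at h2
  simp only [Algebra.algebraMap_self, RingHom.id_apply, Polynomial.eval₂_id,
    Polynomial.expand_eval] at h2
  rw [RatFunc.eval.eq_def _ (w ^ p), Polynomial.eval₂_id, Polynomial.eval₂_id, eq_div_iff hf]
  exact h2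

/-- `RatFunc.eval` is not a ring homomorphism on all rational functions, as division by zero gives
`0` at poles. Lifting to `regularAt w` lets determinants and products commute with evaluation. -/
theorem exists_map_subtype_eq {w : QBar} {M : Matrix (Fin m) (Fin m) (RatFunc QBar)}
    (hM : ∀ i j, M i j ∈ regularAt w) :
    ∃ N : Matrix (Fin m) (Fin m) (regularAt w), (regularAt w).subtype.mapMatrix N = M ∧
      (evalHom w).mapMatrix N = evalAt M w :=
  ⟨Matrix.of fun i j => ⟨M i j, hM i j⟩, rfl, rfl⟩

theorem det_regularAt {w : QBar} {M : Matrix (Fin m) (Fin m) (RatFunc QBar)}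
    (hM : ∀ i j, M i j ∈ regularAt w) :
    M.det ∈ regularAt w ∧ RatFunc.eval (RingHom.id QBar) w M.det = (evalAt M w).det := by
  obtain ⟨N, rfl, h2⟩ := exists_map_subtype_eq hM
  rw [← h2, ← RingHom.map_det, ← RingHom.map_det]
  exact ⟨N.det.2, rfl⟩

theorem vecMul_regularAt {w : QBar} {M : Matrix (Fin m) (Fin m) (RatFunc QBar)}
    (hM : ∀ i j, M i j ∈ regularAt w) {u : Fin m → RatFunc QBar} (hu : ∀ i, u i ∈ regularAt w)
    (j : Fin m) :
    (u ᵥ* M) j ∈ regularAt w ∧ RatFunc.eval (RingHom.id QBar) w ((u ᵥ* M) j) =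
      ((fun i => RatFunc.eval (RingHom.id QBar) w (u i)) ᵥ* evalAt M w) j := by
  obtain ⟨N, rfl, h2⟩ := exists_map_subtype_eq hM
  have h3 := RingHom.map_vecMul (regularAt w).subtype N (fun i => ⟨u i, hu i⟩) j
  have h4 := RingHom.map_vecMul (evalHom w) N (fun i => ⟨u i, hu i⟩) j
  rw [← h2]
  refine ⟨?_, ?_⟩
  · exact h3 ▸ Subtype.coe_prop _
  · exact (congrArg _ h3.symm).trans h4

/-! ### The cyclic vector -/

/-- Each new row at `w` is the previous row at `w^p` times `A(w)`, so induction runs over `w` and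
`e` together: the case `w^p`, `e A(w)⁻¹` gives the case `w`, `e`. Here `A(w)⁻¹` is the first factor
of the product in `hr`. -/
theorem cyclicRow_eval {A : Matrix (Fin m) (Fin m) (RatFunc QBar)} {r : Fin m → Polynomial QBar}
    (i : ℕ) {w : QBar} (hA : ∀ l : ℕ, ∀ a b, A a b ∈ regularAt (w ^ p ^ l))
    (hdet : ∀ l : ℕ, IsUnit (evalAt A (w ^ p ^ l)).det) {e : Fin m → QBar}
    (hr : (fun j => (r j).eval (w ^ p ^ i)) =
      e ᵥ* ((List.range i).map (fun l => (evalAt A (w ^ p ^ l))⁻¹)).prod) (j : Fin m) :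
    cyclicRow p A r i j ∈ regularAt w ∧
      RatFunc.eval (RingHom.id QBar) w (cyclicRow p A r i j) = e j := by
  induction i generalizing w e j with
  | zero =>
    have h1 := congrFun hr j
    simp only [pow_zero, pow_one, List.range_zero, List.map_nil, List.prod_nil,
      Matrix.vecMul_one] at h1
    rw [cyclicRow, mem_regularAt, RatFunc.denom_algebraMap, RatFunc.eval_algebraMap]
    simpa using h1
  | succ i ih =>
    have hw : ∀ l : ℕ, (w ^ p) ^ p ^ l = w ^ p ^ (l + 1) := fun l => by
      rw [← pow_mul, pow_succ']
    have h0 : w ^ p ^ 0 = w := by simp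
    have hrow := fun j => ih (w := w ^ p) (e := e ᵥ* (evalAt A w)⁻¹)
      (fun l => by rw [hw]; exact hA _) (fun l => by rw [hw]; exact hdet _) (by
        simp only [hw]
        rw [hr, List.range_succ_eq_map, List.map_cons, List.prod_cons, List.map_map,
          Matrix.vecMul_vecMul, h0]
        rfl) j
    have hdet0 := hdet 0
    have hA0 := hA 0
    rw [h0] at hdet0 hA0
    have hφ := fun j => ratMahler_regularAt (hrow j).1
    have h1 := vecMul_regularAt hA0 (fun j => (hφ j).1) j
    refine ⟨h1.1, h1.2.trans ?_⟩
    have h2 : (fun j => RatFunc.eval (RingHom.id QBar) w (ratMahler p (cyclicRow p A r i j))) =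
        e ᵥ* (evalAt A w)⁻¹ := funext fun j => (hφ j).2.trans (hrow j).2
    rw [h2, Matrix.vecMul_vecMul, Matrix.nonsing_inv_mul _ hdet0, Matrix.vecMul_one]

theorem one_le_rootBound (A : Matrix (Fin m) (Fin m) (RatFunc QBar)) : 1 ≤ rootBound A := by
  rw [rootBound, Finset.le_fold_max]
  left
  rw [Polynomial.cauchyBound]
  exact_mod_cast le_add_of_nonneg_left zero_le

/-- Strictness makes the nodes `z₀^(p^k)` distinct and keeps their absolute values above the root
bound. -/
theorem one_lt_startPoint (A : Matrix (Fin m) (Fin m) (RatFunc QBar)) : 1 < startPoint A := by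
  rw [startPoint]
  split_ifs with h
  · norm_num
  · exact lt_of_le_of_ne (one_le_rootBound A) (Ne.symm h)

theorem rootBound_le_startPoint (A : Matrix (Fin m) (Fin m) (RatFunc QBar)) :
    rootBound A ≤ startPoint A := by
  rw [startPoint]
  split_ifs with h
  · rw [h]; norm_num
  · exact le_rfl

theorem norm_of_eq_startPoint {A : Matrix (Fin m) (Fin m) (RatFunc QBar)} {z : QBar}
    (hz : (z : ℂ) = ((startPoint A : ℝ) : ℂ)) : ‖z‖ = startPoint A := by
  change ‖(z : ℂ)‖ = _
  rw [hz, Complex.norm_real, Real.norm_of_nonneg]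
  linarith [one_lt_startPoint A]

/-- Roots are strictly smaller than the Cauchy bound, so equality `‖w‖ = rootBound A` is allowed. -/
theorem regular_of_rootBound_le {A : Matrix (Fin m) (Fin m) (RatFunc QBar)} (hA : A.det ≠ 0)
    {w : QBar} (hw : rootBound A ≤ ‖w‖) :
    (∀ a b, A a b ∈ regularAt w) ∧ IsUnit (evalAt A w).det := by
  have hroot : ∀ g : Polynomial QBar, g ≠ 0 → (g.cauchyBound : ℝ) ≤ rootBound A →
      g.eval w ≠ 0 := by
    intro g hg hle h0
    have h1 : (‖w‖₊ : ℝ) < g.cauchyBound := by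
      exact_mod_cast Polynomial.IsRoot.norm_lt_cauchyBound hg h0
    rw [coe_nnnorm] at h1
    linarith
  have hreg : ∀ a b, A a b ∈ regularAt w := fun a b =>
    hroot _ (RatFunc.denom_ne_zero _) (by
      rw [rootBound, Finset.le_fold_max]
      exact Or.inr ⟨(a, b), Finset.mem_univ _, le_rfl⟩)
  obtain ⟨h1, h2⟩ := det_regularAt hreg
  refine ⟨hreg, ?_⟩
  rw [← h2, isUnit_iff_ne_zero, RatFunc.eval, Polynomial.eval₂_id, Polynomial.eval₂_id]
  refine div_ne_zero (hroot _ (RatFunc.num_ne_zero hA) ?_) h1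
  rw [rootBound, Finset.le_fold_max]
  exact Or.inl le_rfl

theorem CyclicVectorOutput.isUnit_and_eq_companion {A : Matrix (Fin m) (Fin m) (RatFunc QBar)}
    (hA : A.det ≠ 0) {P : Matrix (Fin m) (Fin m) (RatFunc QBar)} {q : Fin m → RatFunc QBar}
    (h : CyclicVectorOutput p A P q) :
    IsUnit P ∧ P.map (ratMahler p) * A * P⁻¹ = companion q := by
  obtain ⟨z, r, hz, hr, hP, hq⟩ := h
  have hnorm := norm_of_eq_startPoint hz
  have hgood := fun l : ℕ => regular_of_rootBound_le hA (w := z ^ p ^ l) (by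
    rw [norm_pow, hnorm]
    exact (rootBound_le_startPoint A).trans (le_self_pow₀ (one_lt_startPoint A).le
      (pow_ne_zero l (NeZero.ne p))))
  have hrow := fun i : Fin m => cyclicRow_eval (i : ℕ) (fun l => (hgood l).1)
    (fun l => (hgood l).2) (hr i)
  have hPdet : IsUnit P.det := by
    have h1 := (det_regularAt (M := P) (w := z) fun i j => by
      rw [hP]; exact (hrow i j).1).2
    -- The interpolation conditions were chosen so that row `i` of `P` takes the value `e_i` at `z`.
    have h2 : evalAt P z = 1 := by
      ext i j : 2
      rw [evalAt, Matrix.map_apply, hP, Matrix.of_apply, (hrow i j).2, Matrix.one_apply,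
        Pi.single_apply]
      simp only [eq_comm]
    rw [isUnit_iff_ne_zero]
    intro h0
    rw [h0, h2, Matrix.det_one, RatFunc.eval_zero] at h1
    exact zero_ne_one h1
  refine ⟨(Matrix.isUnit_iff_isUnit_det _).2 hPdet, ?_⟩
  have hmul : ∀ i : Fin m, (P.map (ratMahler p) * A) i = cyclicRow p A r (i + 1) := by
    intro i
    rw [hP]
    rfl
  ext i j : 2
  rw [Matrix.mul_apply_eq_vecMul, hmul]
  simp only [companion, Matrix.of_apply]
  split_ifs with h1 h2
  · rw [hq, h1]
  · have h3 : cyclicRow p A r (i + 1) = P j := by rw [hP, ← h2]; rfl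
    rw [h3, ← Matrix.mul_apply_eq_vecMul, Matrix.mul_nonsing_inv _ hPdet, Matrix.one_apply_eq]
  · have h4 : (i : ℕ) + 1 < m := by have := i.2; omega
    have h3 : cyclicRow p A r (i + 1) = P ⟨i + 1, h4⟩ := by rw [hP]; rfl
    rw [h3, ← Matrix.mul_apply_eq_vecMul, Matrix.mul_nonsing_inv _ hPdet, Matrix.one_apply_ne]
    intro h5
    exact h2 (by rw [← h5])

/-! ### Existence of an output -/

/-- The square of `|x|` is `x` times its complex conjugate. This makes the starting point algebraic.
-/
theorem norm_mem_algebraicClosure (x : QBar) : ((‖x‖ : ℝ) : ℂ) ∈ algebraicClosure ℚ ℂ := by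
  have hx : IsAlgebraic ℚ (x : ℂ) := mem_algebraicClosure_iff.1 x.2
  have hc : IsAlgebraic ℚ ((starRingEnd ℂ) (x : ℂ)) :=
    hx.algHom (Complex.conjAe.toAlgHom.restrictScalars ℚ)
  have h2 : ((‖x‖ : ℝ) : ℂ) ^ 2 = x * (starRingEnd ℂ) (x : ℂ) := by
    rw [Complex.mul_conj, Complex.normSq_eq_norm_sq]
    push_cast
    rfl
  refine mem_algebraicClosure_iff.2 (IsAlgebraic.of_pow two_pos ?_)
  rw [h2]
  exact hx.mul hc

theorem cauchyBound_mem_algebraicClosure (g : Polynomial QBar) :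
    (((g.cauchyBound : NNReal) : ℝ) : ℂ) ∈ algebraicClosure ℚ ℂ := by
  rw [Polynomial.cauchyBound]
  push_cast
  refine add_mem (div_mem ?_ (norm_mem_algebraicClosure _)) (one_mem _)
  refine Finset.sup_induction
    (p := fun x : NNReal => (((x : ℝ)) : ℂ) ∈ algebraicClosure ℚ ℂ) ?_ ?_ ?_
  · simp
  · intro a ha b hb
    rcases max_choice a b with h | h <;> rw [h] <;> assumption
  · exact fun i _ => norm_mem_algebraicClosure _

theorem startPoint_mem_algebraicClosure (A : Matrix (Fin m) (Fin m) (RatFunc QBar)) :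
    ((startPoint A : ℝ) : ℂ) ∈ algebraicClosure ℚ ℂ := by
  have h : ((rootBound A : ℝ) : ℂ) ∈ algebraicClosure ℚ ℂ := by
    rw [rootBound]
    induction (Finset.univ : Finset (Fin m × Fin m)) using Finset.induction_on with
    | empty => exact cauchyBound_mem_algebraicClosure _
    | insert a s ha ih =>
      rw [Finset.fold_insert ha]
      rcases max_choice ((Polynomial.cauchyBound (A a.1 a.2).denom : NNReal) : ℝ)
        (s.fold max ((Polynomial.cauchyBound A.det.num : NNReal) : ℝ)
          (fun ij => ((Polynomial.cauchyBound (A ij.1 ij.2).denom : NNReal) : ℝ))) with h | h <;>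
        rw [h]
      · exact cauchyBound_mem_algebraicClosure _
      · exact ih
  rw [startPoint]
  split_ifs
  · exact_mod_cast natCast_mem (algebraicClosure ℚ ℂ) 2
  · exact h

theorem exists_ramificationOutput (hp : 2 ≤ p) (A : Matrix (Fin m) (Fin m) (RatFunc QBar)) :
    ∃ d, RamificationOutput p A d := by
  let z : QBar := ⟨_, startPoint_mem_algebraicClosure A⟩
  have hz : ‖z‖ = startPoint A := norm_of_eq_startPoint rfl
  have hinj : Function.Injective fun k : Fin m => z ^ p ^ (k : ℕ) := by
    intro a b hab
    have h1 := congrArg norm hab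
    simp only [norm_pow, hz] at h1
    exact Fin.ext (Nat.pow_right_injective hp
      (pow_right_injective₀ (by linarith [one_lt_startPoint A]) (one_lt_startPoint A).ne' h1))
  -- The nodes are distinct, so each entry of `r` can be taken to be a Lagrange interpolant.
  let r : Fin m → Polynomial QBar := fun j => Lagrange.interpolate Finset.univ
    (fun k : Fin m => z ^ p ^ (k : ℕ)) fun k => Matrix.vecMul (Pi.single k 1)
      ((List.range (k : ℕ)).map (fun l => (evalAt A (z ^ p ^ l))⁻¹)).prod j
  exact ⟨_, _, _, ⟨z, r, rfl, fun k => funext fun j =>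
    Lagrange.eval_interpolate_at_node _ hinj.injOn (Finset.mem_univ k), rfl, rfl⟩, rfl⟩

end MahlerSystem

theorem mainTheorem4 (p m : ℕ) [p.AtLeastTwo] (hm : 1 ≤ m)
    (A : Matrix.GeneralLinearGroup (Fin m) (RatFunc MahlerSystem.QBar)) :
    -- every gauge transformation to a constant system has a ramification index in `𝒟`
    (∀ Ψ : Matrix.GeneralLinearGroup (Fin m) MahlerSystem.PuiseuxField,
      MahlerSystem.IsConstantGauge p A Ψ →
        ∃ d ∈ MahlerSystem.ramificationSet p m, MahlerSystem.InGLLaurentRoot d Ψ) ∧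
    -- the cyclic vector algorithm never fails: it finds an equivalent companion system
    (∀ P q, MahlerSystem.CyclicVectorOutput p A.val P q →
      IsUnit P ∧ P.map (MahlerSystem.ratMahler p) * A.val * P⁻¹ = MahlerSystem.companion q) ∧
    -- the algorithm for `d` has an output, and each output is such a ramification index
    (∃ d, MahlerSystem.RamificationOutput p A.val d) ∧
    (∀ d, MahlerSystem.RamificationOutput p A.val d →
      d ∈ MahlerSystem.ramificationSet p m ∧
      ∀ Ψ : Matrix.GeneralLinearGroup (Fin m) MahlerSystem.PuiseuxField,
        MahlerSystem.IsConstantGauge p A Ψ → MahlerSystem.InGLLaurentRoot d Ψ) := by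
  have hp : 2 ≤ p := Nat.AtLeastTwo.prop
  have hA : A.val.det ≠ 0 := ((Matrix.isUnit_iff_isUnit_det _).1 A.isUnit).ne_zero
  have hcyc := fun P q (h : MahlerSystem.CyclicVectorOutput p A.val P q) =>
    h.isUnit_and_eq_companion hA
  have hex := MahlerSystem.exists_ramificationOutput hp A.val
  have hout : ∀ d, MahlerSystem.RamificationOutput p A.val d →
      d ∈ MahlerSystem.ramificationSet p m ∧
      ∀ Ψ : Matrix.GeneralLinearGroup (Fin m) MahlerSystem.PuiseuxField,
        MahlerSystem.IsConstantGauge p A Ψ → MahlerSystem.InGLLaurentRoot d Ψ := by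
    rintro d ⟨P, q, hPq, rfl⟩
    obtain ⟨h1, h2⟩ := hcyc P q hPq
    exact ⟨MahlerSystem.newtonIndex_mem_ramificationSet hp hm q,
      fun Ψ hΨ => hΨ.inGLLaurentRoot hp hm h1 h2⟩
  refine ⟨fun Ψ hΨ => ?_, hcyc, hex, hout⟩
  -- Any output of the algorithm serves as the required index, and it does not depend on `Ψ`.
  obtain ⟨d, hd⟩ := hex
  exact ⟨d, (hout d hd).1, (hout d hd).2 Ψ hΨ⟩
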